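/- Let $K$ be a field. A crossed module of Lie algebras over $K$ is a homomorphism $\mu:\mathfrak m\to\mathfrak n$ of Lie algebras together with an action of $\mathfrak n$ on $\mathfrak m$ by derivations such that $\mu(x\cdot a)=[x,\mu(a)]$ and $\mu(a)\cdot b=[a,b]$ for all $x\in\mathfrak n$, $a,b\in\mathfrak m$. Put $V=\ker\mu$ and $\mathfrak g=\operatorname{coker}\mu=\mathfrak n/\mathrm{im}\,\mu$; then $\mathfrak g$ is a Lie algebra, $V$ is a $\mathfrak g$-module through the action of $\mathfrak n$ on $\mathfrak m$, and there is an exact sequence $0\to V\to\mathfrak m\to\mathfrak n\to\mathfrak g\to 0$. For a given Lie algebra $\mathfrak g$ and a given $\mathfrak g$-module $V$, equivalence of crossed modules with kernel $V$ and cokernel $\mathfrak g$ (that is, equipped with such an exact sequence, inducing the given action of $\mathfrak g$ on $V$) is the equivalence relation generated by the pairs $(\mu:\mathfrak m\to\mathfrak n,\ \mu':\mathfrak m'\to\mathfrak n')$ for which there are Lie algebra homomorphisms $\varphi:\mathfrak m\to\mathfrak m'$ and $\psi:\mathfrak n\to\mathfrak n'$, compatible with the actions, that form together with $\mathrm{id}_V$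 and $\mathrm{id}_{\mathfrak g}$ a morphism of exact sequences. Given a short exact sequence $0\to V_1\to V_2\xrightarrow{d}V_3\to0$ of $\mathfrak g$-modules and a 2-cocycle $\alpha\in Z^2(\mathfrak g,V_3)$, let $V_3\times_\alpha\mathfrak g$ be the abelian extension of $\mathfrak g$ by $V_3$ defined by $\alpha$, with bracket $[(v,x),(w,y)]=(x\cdot w-y\cdot v+\alpha(x,y),[x,y])$. Regard $V_2$ as an abelian Lie algebra on which $V_3\times_\alpha\mathfrak g$ acts through $\mathfrak g$. Then $v\mapsto(d(v),0)$ is a crossed module $V_2\to V_3\times_\alpha\mathfrak g$, with exact sequence $0\to V_1\to V_2\to V_3\times_\alpha\mathfrak g\to\mathfrak g\to0$. **Proposition.** Let $\mu:\mathfrak m\to\mathfrak n$ be a crossed module of Lie algebras over $K$, with $V=\ker\mu$ and $\mathfrak g=\operatorname{coker}\mu$. Then there exist a short exact sequence of $\mathfrak g$-modules $0\to V\to V_2\to V_3\to0$ and a 2-cocycle $\alpha\in Z^2(\mathfrak g,V_3)$ such that the crossed module $\mu_1:V_2\to V_3\times_\alpha\mathfrak g$ obtained from them is equivalent to $\mu:\mathfrak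 m\to\mathfrak n$, as crossed modules with kernel $V$ and cokernel $\mathfrak g$. -/

import Mathlib

/-- A crossed module of Lie algebras over `K`: a homomorphism `μ : m → n` of Lie algebras and an
action of `n` on `m` by derivations (a homomorphism of Lie algebras `n → Der m`), such that
`μ (x · a) = [x, μ a]` and `μ a · b = [a, b]`. -/
structure LieCrossedModule (K m n : Type*) [CommRing K] [LieRing m] [LieAlgebra K m]
    [LieRing n] [LieAlgebra K n] where
  μ : m →ₗ⁅K⁆ n
  act : n →ₗ⁅K⁆ LieDerivation K m m
  map_act : ∀ (x : n) (a : m), μ (act x a) = ⁅x, μ a⁆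
  act_map : ∀ a b : m, act (μ a) b = ⁅a, b⁆

namespace LieCrossedModule

variable {K m n : Type*} [CommRing K] [LieRing m] [LieAlgebra K m] [LieRing n] [LieAlgebra K n]

/-- The image of `μ`, an ideal of `n`. -/
def imageIdeal (C : LieCrossedModule K m n) : LieIdeal K n where
  toSubmodule := LinearMap.range (C.μ : m →ₗ[K] n)
  lie_mem := by
    rintro x _ ⟨a, rfl⟩
    exact ⟨C.act x a, C.map_act x a⟩

theorem mem_imageIdeal (C : LieCrossedModule K m n) {x : n} :
    x ∈ C.imageIdeal ↔ ∃ a, C.μ a = x := Iff.rfl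

/-- The Lie algebra `𝔤 = coker μ = n / im μ`. -/
def Coker (C : LieCrossedModule K m n) : Type _ := n ⧸ C.imageIdeal

instance (C : LieCrossedModule K m n) : LieRing C.Coker :=
  inferInstanceAs (LieRing (n ⧸ C.imageIdeal))

instance (C : LieCrossedModule K m n) : LieAlgebra K C.Coker :=
  inferInstanceAs (LieAlgebra K (n ⧸ C.imageIdeal))

/-- The projection `n → 𝔤`. -/
def proj (C : LieCrossedModule K m n) : n →ₗ⁅K⁆ C.Coker where
  toLinearMap := (C.imageIdeal : Submodule K n).mkQ
  map_lie' := rfl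

theorem proj_surjective (C : LieCrossedModule K m n) : Function.Surjective C.proj :=
  Submodule.mkQ_surjective _

theorem proj_eq_zero (C : LieCrossedModule K m n) {x : n} :
    C.proj x = 0 ↔ x ∈ Set.range C.μ :=
  (Submodule.Quotient.mk_eq_zero (C.imageIdeal : Submodule K n)).trans C.mem_imageIdeal

/-- The `K`-module `V = ker μ`. -/
def Ker (C : LieCrossedModule K m n) : Type _ := LinearMap.ker (C.μ : m →ₗ[K] n)

instance (C : LieCrossedModule K m n) : AddCommGroup C.Ker :=
  inferInstanceAs (AddCommGroup (LinearMap.ker (C.μ : m →ₗ[K] n)))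

instance (C : LieCrossedModule K m n) : Module K C.Ker :=
  inferInstanceAs (Module K (LinearMap.ker (C.μ : m →ₗ[K] n)))

/-- The inclusion `V → m`. -/
def incl (C : LieCrossedModule K m n) : C.Ker →ₗ[K] m :=
  (LinearMap.ker (C.μ : m →ₗ[K] n)).subtype

theorem incl_injective (C : LieCrossedModule K m n) : Function.Injective C.incl :=
  Subtype.val_injective

theorem map_incl (C : LieCrossedModule K m n) (v : C.Ker) : C.μ (C.incl v) = 0 := v.2

/-- The action of `n` on `V = ker μ`. -/
def kerAct (C : LieCrossedModule K m n) : n →ₗ[K] C.Ker →ₗ[K] C.Ker :=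
  LinearMap.mk₂ K
    (fun x v ↦ (⟨C.act x (C.incl v),
      (C.map_act x (C.incl v)).trans (by rw [C.map_incl, lie_zero])⟩ :
      LinearMap.ker (C.μ : m →ₗ[K] n)))
    (fun x y v ↦ Subtype.ext
      (show C.act (x + y) (C.incl v) = C.act x (C.incl v) + C.act y (C.incl v) by simp))
    (fun t x v ↦ Subtype.ext
      (show C.act (t • x) (C.incl v) = t • C.act x (C.incl v) by simp))
    (fun x v w ↦ Subtype.ext
      (show C.act x (C.incl (v + w)) = C.act x (C.incl v) + C.act x (C.incl w) by simp))
    (fun t x v ↦ Subtype.ext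
      (show C.act x (C.incl (t • v)) = t • C.act x (C.incl v) by simp))

theorem incl_kerAct (C : LieCrossedModule K m n) (x : n) (v : C.Ker) :
    C.incl (C.kerAct x v) = C.act x (C.incl v) := rfl

theorem kerAct_map (C : LieCrossedModule K m n) (a : m) : C.kerAct (C.μ a) = 0 := by
  ext v
  apply C.incl_injective
  rw [C.incl_kerAct, C.act_map, ← lie_skew, ← C.act_map, C.map_incl]
  simp

/-- The action of `𝔤 = coker μ` on `V = ker μ` induced by the action of `n` on `m`. -/
def cokerAct (C : LieCrossedModule K m n) : C.Coker →ₗ[K] C.Ker →ₗ[K] C.Ker :=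
  (C.imageIdeal : Submodule K n).liftQ C.kerAct (by
    rintro _ ⟨a, rfl⟩
    exact C.kerAct_map a)

theorem cokerAct_proj (C : LieCrossedModule K m n) (x : n) (v : C.Ker) :
    C.cokerAct (C.proj x) v = C.kerAct x v := rfl

instance (C : LieCrossedModule K m n) : LieRingModule C.Coker C.Ker where
  bracket x v := C.cokerAct x v
  add_lie x y v := by simp
  lie_add x v w := by simp
  leibniz_lie x y v := by
    obtain ⟨x, rfl⟩ := C.proj_surjective x
    obtain ⟨y, rfl⟩ := C.proj_surjective y
    apply C.incl_injective
    rw [← LieHom.map_lie, map_add]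
    simp only [C.cokerAct_proj, C.incl_kerAct]
    simp [LieDerivation.lie_apply]

theorem proj_lie (C : LieCrossedModule K m n) (x : n) (v : C.Ker) :
    ⁅C.proj x, v⁆ = C.kerAct x v := rfl

instance (C : LieCrossedModule K m n) : LieModule K C.Coker C.Ker where
  smul_lie t x v := by
    change C.cokerAct (t • x) v = t • C.cokerAct x v
    simp
  lie_smul t x v := by
    change C.cokerAct x (t • v) = t • C.cokerAct x v
    simp

end LieCrossedModule

/-- A crossed module of Lie algebras with kernel `V` and cokernel `g`, where `g` is a given Lie
algebra and `V` a given `g`-module: a crossed module `μ : m → n` with a four term exact sequence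
`0 → V → m → n → g → 0` such that the action of `g` on `V` is the one induced by the crossed
module. -/
structure LieCrossedModuleOver.{uK, uG, uV, w} (K : Type uK) (g : Type uG) (V : Type uV)
    [CommRing K] [LieRing g] [LieAlgebra K g] [AddCommGroup V] [Module K V] [LieRingModule g V]
    [LieModule K g V] where
  m : Type w
  n : Type w
  [lieRing_m : LieRing m]
  [lieAlgebra_m : LieAlgebra K m]
  [lieRing_n : LieRing n]
  [lieAlgebra_n : LieAlgebra K n]
  crossed : LieCrossedModule K m n
  i : V →ₗ[K] m
  π : n →ₗ⁅K⁆ g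
  i_injective : Function.Injective i
  exact_m : Function.Exact i crossed.μ
  exact_n : Function.Exact crossed.μ π
  π_surjective : Function.Surjective π
  i_lie : ∀ (x : n) (v : V), i ⁅π x, v⁆ = crossed.act x (i v)

namespace LieCrossedModuleOver

attribute [instance] lieRing_m lieAlgebra_m lieRing_n lieAlgebra_n

variable {K g V : Type*} [CommRing K] [LieRing g] [LieAlgebra K g] [AddCommGroup V] [Module K V]
  [LieRingModule g V] [LieModule K g V]

/-- There is an elementary equivalence from `X` to `Y`: homomorphisms of Lie algebras
`φ : m → m'` and `ψ : n → n'`, compatible with the actions, that form with the identities of `V`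
and `g` a morphism of four term exact sequences. -/
def ElementaryEquivalence (X Y : LieCrossedModuleOver K g V) : Prop :=
  ∃ (φ : X.m →ₗ⁅K⁆ Y.m) (ψ : X.n →ₗ⁅K⁆ Y.n),
    (∀ a, Y.crossed.μ (φ a) = ψ (X.crossed.μ a)) ∧
    (∀ x a, φ (X.crossed.act x a) = Y.crossed.act (ψ x) (φ a)) ∧
    (∀ v, φ (X.i v) = Y.i v) ∧
    (∀ x, Y.π (ψ x) = X.π x)

/-- Equivalence of crossed modules with kernel `V` and cokernel `g`: the equivalence relation
generated by the elementary equivalences. -/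
def Equivalent (X Y : LieCrossedModuleOver K g V) : Prop :=
  Relation.EqvGen ElementaryEquivalence X Y

end LieCrossedModuleOver

/-- A crossed module `μ : m → n`, as a crossed module with kernel `ker μ` and cokernel
`coker μ`. -/
def LieCrossedModule.toOver.{uK, w} {K : Type uK} {m n : Type w} [CommRing K] [LieRing m]
    [LieAlgebra K m] [LieRing n] [LieAlgebra K n] (C : LieCrossedModule K m n) :
    LieCrossedModuleOver.{uK, w, w, w} K C.Coker C.Ker where
  m := m
  n := n
  crossed := C
  i := C.incl
  π := C.proj
  i_injective := C.incl_injective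
  exact_m a := ⟨fun h ↦ ⟨⟨a, h⟩, rfl⟩, by rintro ⟨v, rfl⟩; exact C.map_incl v⟩
  exact_n _ := C.proj_eq_zero
  π_surjective := C.proj_surjective
  i_lie _ _ := rfl

/-- A `K`-module, regarded as an abelian Lie algebra. -/
def AbelianLie (V : Type*) : Type _ := V

namespace AbelianLie

instance (V : Type*) [AddCommGroup V] : AddCommGroup (AbelianLie V) :=
  inferInstanceAs (AddCommGroup V)

instance (K V : Type*) [CommRing K] [AddCommGroup V] [Module K V] : Module K (AbelianLie V) :=
  inferInstanceAs (Module K V)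

instance (V : Type*) [AddCommGroup V] : LieRing (AbelianLie V) where
  bracket _ _ := 0
  add_lie _ _ _ := (add_zero 0).symm
  lie_add _ _ _ := (add_zero 0).symm
  lie_self _ := rfl
  leibniz_lie _ _ _ := (add_zero 0).symm

instance (K V : Type*) [CommRing K] [AddCommGroup V] [Module K V] :
    LieAlgebra K (AbelianLie V) where
  lie_smul t _ _ := (smul_zero t).symm

theorem lie_eq_zero {V : Type*} [AddCommGroup V] (v w : AbelianLie V) : ⁅v, w⁆ = 0 := rfl

/-- The identity map. -/
def of (K V : Type*) [CommRing K] [AddCommGroup V] [Module K V] : V ≃ₗ[K] AbelianLie V :=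
  LinearEquiv.refl K V

end AbelianLie

section Splice

open LieModule.Cohomology

variable {K g V₁ V₂ V₃ : Type*} [CommRing K] [LieRing g] [LieAlgebra K g]
  [AddCommGroup V₁] [Module K V₁] [LieRingModule g V₁] [LieModule K g V₁]
  [AddCommGroup V₂] [Module K V₂] [LieRingModule g V₂] [LieModule K g V₂]
  [AddCommGroup V₃] [Module K V₃] [LieRingModule g V₃] [LieModule K g V₃]

/-- The projection `V₃ ×_α g → g`. (In `LieAlgebra.ofTwoCocycle α` the component in `g` comes
first.) -/
def spliceProj (α : twoCocycle K g V₃) : LieAlgebra.ofTwoCocycle α →ₗ⁅K⁆ g where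
  toFun x := ((LieAlgebra.ofProd α).symm x).1
  map_add' _ _ := rfl
  map_smul' _ _ := rfl
  map_lie' := rfl

/-- The map `V₂ → V₃ ×_α g`, `v ↦ (d v, 0)`. -/
def spliceMap (d : V₂ →ₗ⁅K, g⁆ V₃) (α : twoCocycle K g V₃) :
    AbelianLie V₂ →ₗ⁅K⁆ LieAlgebra.ofTwoCocycle α where
  toFun v := LieAlgebra.ofProd α (0, d ((AbelianLie.of K V₂).symm v))
  map_add' v w := by simp [← LieAlgebra.of_add]
  map_smul' t v := by simp [← LieAlgebra.of_smul]
  map_lie' {v w} := by simp [AbelianLie.lie_eq_zero, LieAlgebra.bracket_ofTwoCocycle]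

/-- The action of `g` on the abelian Lie algebra `V₂`. -/
def spliceAct (K g V₂ : Type*) [CommRing K] [LieRing g] [LieAlgebra K g] [AddCommGroup V₂]
    [Module K V₂] [LieRingModule g V₂] [LieModule K g V₂] :
    g →ₗ⁅K⁆ LieDerivation K (AbelianLie V₂) (AbelianLie V₂) where
  toFun x :=
    { toLinearMap := (AbelianLie.of K V₂).conj (LieModule.toEnd K g V₂ x)
      leibniz' := fun v w ↦ by simp [AbelianLie.lie_eq_zero] }
  map_add' x y := by ext v; simp
  map_smul' t x := by ext v; simp
  map_lie' {x y} := by ext v; simp [LieDerivation.lie_apply, LinearEquiv.conj_apply]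

theorem spliceAct_of (x : g) (v : V₂) :
    spliceAct K g V₂ x (AbelianLie.of K V₂ v) = AbelianLie.of K V₂ ⁅x, v⁆ := rfl

/-- The crossed module `V₂ → V₃ ×_α g`, `v ↦ (d v, 0)`, where `V₂` is an abelian Lie algebra on
which `V₃ ×_α g` acts through `g`. -/
def spliceCrossed (d : V₂ →ₗ⁅K, g⁆ V₃) (α : twoCocycle K g V₃) :
    LieCrossedModule K (AbelianLie V₂) (LieAlgebra.ofTwoCocycle α) where
  μ := spliceMap d α
  act := (spliceAct K g V₂).comp (spliceProj α)
  map_act x v := by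
    obtain ⟨v, rfl⟩ := (AbelianLie.of K V₂).surjective v
    rw [LieHom.comp_apply, spliceAct_of]
    change LieAlgebra.ofProd α (0, d ⁅((LieAlgebra.ofProd α).symm x).1, v⁆) =
      ⁅x, LieAlgebra.ofProd α (0, d v)⁆
    simp [LieAlgebra.bracket_ofTwoCocycle]
  act_map v w := by
    have h : spliceProj α (spliceMap d α v) = 0 := rfl
    rw [LieHom.comp_apply, h, map_zero, AbelianLie.lie_eq_zero]
    rfl

end Splice

/-- The Yoneda product of a short exact sequence `0 → V₁ → V₂ → V₃ → 0` of `g`-modules and the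
abelian extension `0 → V₃ → V₃ ×_α g → g → 0` given by a 2-cocycle `α`: the crossed module
`V₂ → V₃ ×_α g` with its exact sequence `0 → V₁ → V₂ → V₃ ×_α g → g → 0`. -/
def LieCrossedModuleOver.splice.{uK, w} {K : Type uK} {g V₁ V₂ V₃ : Type w} [CommRing K]
    [LieRing g] [LieAlgebra K g]
    [AddCommGroup V₁] [Module K V₁] [LieRingModule g V₁] [LieModule K g V₁]
    [AddCommGroup V₂] [Module K V₂] [LieRingModule g V₂] [LieModule K g V₂]
    [AddCommGroup V₃] [Module K V₃] [LieRingModule g V₃] [LieModule K g V₃]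
    (i : V₁ →ₗ⁅K, g⁆ V₂) (d : V₂ →ₗ⁅K, g⁆ V₃)
    (hi : Function.Injective i) (hid : Function.Exact i d) (hd : Function.Surjective d)
    (α : LieModule.Cohomology.twoCocycle K g V₃) :
    LieCrossedModuleOver.{uK, w, w, w} K g V₁ where
  m := AbelianLie V₂
  n := LieAlgebra.ofTwoCocycle α
  crossed := spliceCrossed d α
  i := (AbelianLie.of K V₂ : V₂ →ₗ[K] AbelianLie V₂) ∘ₗ (i : V₁ →ₗ[K] V₂)
  π := spliceProj α
  i_injective := hi
  exact_m v :=
    ⟨fun h ↦ (hid v).1 (congrArg (fun x ↦ ((LieAlgebra.ofProd α).symm x).2) h),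
      fun h ↦ congrArg (fun w ↦ LieAlgebra.ofProd α (0, w)) ((hid v).2 h)⟩
  exact_n x := by
    constructor
    · intro h
      obtain ⟨v, hv⟩ := hd ((LieAlgebra.ofProd α).symm x).2
      exact ⟨v, (LieAlgebra.ofProd α).symm.injective (Prod.ext (Eq.symm h) hv)⟩
    · rintro ⟨v, rfl⟩
      rfl
  π_surjective x := ⟨LieAlgebra.ofProd α (x, 0), rfl⟩
  i_lie x v := i.map_lie (spliceProj α x) v

universe u v

/-! Write V for `ker μ`. The aim is an `n`-module Q with a linear map j : m → Q that is a 1-cocycle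
for the action through μ, is injective on V, and is `n`-equivariant up to coboundaries: for each x
in n, the map a ↦ x·j(a) − j(x·a) has the form a ↦ μ(a)·q.

Such a Q yields the abelian model. V₂ is the space of elements of Q killed by im μ, −j embeds V in
it, and V₃ = V₂/V. The elements q can be chosen as a linear function J(x), with J ∘ μ equal to j
modulo j(V) (`nonempty_splitting`). The coboundary of J takes values in V₂ and, modulo V, descends
to the cocycle α on 𝔤 (`exists_twoCocycle`). The pairs (q, x) in Q ⋊ n with μ(a)·q = x·j(a) − j(x·a)
for all a form a Lie algebra, and (a, v) ↦ (j(a) + v, μ(a)) is a crossed module from m × V₂ to it.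
This one maps to μ and to the spliced crossed module (`spanOver_to`, `spanOver_to_splice`), so the
two are equivalent.

For Q take the coinduced module Hom(U(n), V). The algebra m is a central extension of im μ by V, and
U(n) is free over U(im μ), so Hom(U(n), V) is acyclic over im μ. Vanishing of the class of the
extension gives j (`exists_cocycle`), and vanishing of first cohomology gives equivariance up to
coboundaries (`exists_splitting_module`). U(L) is modelled by the action of L on polynomials in an
ordered basis (`rep`, `rep_lie`); freeness over an ideal is `exists_extension` and
`eq_of_extension`. -/

namespace LieAlgebra.PBW

/-! ### The Poincaré–Birkhoff–Witt representation on polynomials. -/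

open Multiset (card card_cons cons_swap)

/-- The free module on the monomials (finite multisets) in a set of variables. -/
def Poly (K ι : Type*) [CommRing K] := Multiset ι →₀ K

section Poly

noncomputable instance (K ι : Type*) [CommRing K] : AddCommGroup (Poly K ι) :=
  inferInstanceAs (AddCommGroup (Multiset ι →₀ K))

noncomputable instance (K ι : Type*) [CommRing K] : Module K (Poly K ι) :=
  inferInstanceAs (Module K (Multiset ι →₀ K))

/-- The basis of monomials. -/
noncomputable def monoBasis (K ι : Type*) [CommRing K] :
    Module.Basis (Multiset ι) K (Poly K ι) :=
  .ofRepr (LinearEquiv.refl K (Multiset ι →₀ K))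

/-- The basis vector of a monomial. -/
noncomputable def mono (K : Type*) {ι : Type*} [CommRing K] (M : Multiset ι) : Poly K ι :=
  monoBasis K ι M

/-- The linear map with given values at the monomials. -/
noncomputable def lift {K ι X : Type*} [CommRing K] [AddCommGroup X] [Module K X]
    (f : Multiset ι → X) : Poly K ι →ₗ[K] X :=
  (monoBasis K ι).constr K f

@[simp]
theorem lift_mono {K ι X : Type*} [CommRing K] [AddCommGroup X] [Module K X]
    (f : Multiset ι → X) (M : Multiset ι) : lift f (mono K M) = f M :=
  (monoBasis K ι).constr_basis K f M

variable {K ι : Type*} [CommRing K]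

/-- The polynomials of degree at most `d`. -/
noncomputable def degreeLE (K ι : Type*) [CommRing K] (d : ℕ) : Submodule K (Poly K ι) :=
  Submodule.span K {s | ∃ M : Multiset ι, card M ≤ d ∧ mono K M = s}

theorem mono_mem_degreeLE {M : Multiset ι} {d : ℕ} (h : card M ≤ d) :
    mono K M ∈ degreeLE K ι d :=
  Submodule.subset_span ⟨M, h, rfl⟩

theorem degreeLE_mono {d e : ℕ} (h : d ≤ e) : degreeLE K ι d ≤ degreeLE K ι e :=
  Submodule.span_mono fun _ ⟨M, hM, e⟩ ↦ ⟨M, hM.trans h, e⟩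

theorem degreeLE_le {d : ℕ} {p : Submodule K (Poly K ι)}
    (h : ∀ M : Multiset ι, card M ≤ d → mono K M ∈ p) : degreeLE K ι d ≤ p :=
  Submodule.span_le.2 (by rintro _ ⟨M, hM, rfl⟩; exact h M hM)

theorem exists_mem_degreeLE (s : Poly K ι) : ∃ d, s ∈ degreeLE K ι d := by
  have : s ∈ Submodule.span K (Set.range (monoBasis K ι)) := by
    rw [(monoBasis K ι).span_eq]
    trivial
  induction this using Submodule.span_induction with
  | mem _ h =>
    obtain ⟨M, rfl⟩ := h
    exact ⟨card M, mono_mem_degreeLE le_rfl⟩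
  | zero => exact ⟨0, zero_mem _⟩
  | add s t _ _ hs ht =>
    obtain ⟨d, hd⟩ := hs
    obtain ⟨e, he⟩ := ht
    exact ⟨max d e, add_mem (degreeLE_mono (le_max_left _ _) hd)
      (degreeLE_mono (le_max_right _ _) he)⟩
  | smul c s _ hs =>
    obtain ⟨d, hd⟩ := hs
    exact ⟨d, Submodule.smul_mem _ _ hd⟩

/-- Two linear maps that agree on the monomials of degree at most `d` agree on `degreeLE d`. -/
theorem eqOn_degreeLE {X : Type*} [AddCommGroup X] [Module K X] {f g : Poly K ι →ₗ[K] X} {d : ℕ}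
    (h : ∀ M : Multiset ι, card M ≤ d → f (mono K M) = g (mono K M)) {s : Poly K ι}
    (hs : s ∈ degreeLE K ι d) : f s = g s :=
  degreeLE_le (p := LinearMap.eqLocus f g) h hs

theorem eq_zero_or_exists_min [LinearOrder ι] (M : Multiset ι) :
    M = 0 ∨ ∃ (k : ι) (N : Multiset ι), M = k ::ₘ N ∧ ∀ i ∈ N, k ≤ i := by
  rcases h : M.sort (· ≤ ·) with _ | ⟨k, l⟩
  · left
    rw [← M.sort_eq (· ≤ ·), h]
    rfl
  · right
    have hp := M.pairwise_sort (· ≤ ·)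
    rw [h] at hp
    refine ⟨k, l, ?_, fun i hi ↦ ?_⟩
    · rw [← M.sort_eq (· ≤ ·), h]
      rfl
    · exact List.rel_of_pairwise_cons hp (by simpa using hi)

end Poly

theorem apply_eq_of_basis {R V W X κ : Type*} [CommRing R] [AddCommGroup V] [Module R V]
    [AddCommGroup W] [Module R W] [AddCommGroup X] [Module R X] (b : Module.Basis κ R V)
    {f g : V →ₗ[R] W →ₗ[R] X} {w : W} (h : ∀ i, f (b i) w = g (b i) w) (x : V) :
    f x w = g x w := by
  suffices f.flip w = g.flip w from congr($this x)
  exact b.ext h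

variable {K L ι : Type*} [CommRing K] [LieRing L] [LieAlgebra K L] [LinearOrder ι]
  (b : Module.Basis ι K L)

/-- Successive approximations to the action of `L` on the ordered monomials in a basis: the `n`-th
one is the action on polynomials of degree at most `n`. -/
noncomputable def approx : ℕ → L →ₗ[K] Poly K ι →ₗ[K] Poly K ι
  -- Commutative multiplication, which is the right action only on constants.
  | 0 => b.constr K fun j ↦ lift fun M ↦ mono K (j ::ₘ M)
  | n + 1 => b.constr K fun j ↦ lift fun M ↦
      mono K (j ::ₘ M) +
        match M.sort (· ≤ ·) with
        | [] => 0
        | k :: l => if j ≤ k then 0 else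
          -- From x_j x_k N = x_k x_j N + [x_j, x_k] N. The leading part of x_j N is subtracted
          -- because x_k times it is the monomial already written in front; what remains has degree
          -- at most that of N, where the previous approximation suffices.
          approx n (b k) (approx n (b j) (mono K (l : Multiset ι)) - mono K (j ::ₘ (l : Multiset ι)))
            + approx n ⁅b j, b k⁆ (mono K (l : Multiset ι))

theorem approx_lead (n : ℕ) {j : ι} {M : Multiset ι} (h : ∀ i ∈ M, j ≤ i) :
    approx b n (b j) (mono K M) = mono K (j ::ₘ M) := by
  cases n with
  | zero => simp [approx, Module.Basis.constr_basis]
  | succ n =>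
    rw [approx, Module.Basis.constr_basis, lift_mono]
    rcases h' : M.sort (· ≤ ·) with _ | ⟨k, l⟩
    · simp
    · have : k ∈ M := by
        rw [← M.mem_sort (· ≤ ·), h']
        simp
      simp [h k this]

theorem approx_step (n : ℕ) {j k : ι} {N : Multiset ι} (hkj : k < j) (h : ∀ i ∈ N, k ≤ i) :
    approx b (n + 1) (b j) (mono K (k ::ₘ N)) = mono K (j ::ₘ k ::ₘ N) +
      (approx b n (b k) (approx b n (b j) (mono K N) - mono K (j ::ₘ N)) +
        approx b n ⁅b j, b k⁆ (mono K N)) := by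
  rw [approx, Module.Basis.constr_basis, lift_mono,
    Multiset.sort_cons k N (· ≤ ·) h]
  simp only [not_le.2 hkj, if_false, Multiset.sort_eq]

theorem map_mem_of_basis {R V X κ : Type*} [CommRing R] [AddCommGroup V] [Module R V]
    [AddCommGroup X] [Module R X] (b : Module.Basis κ R V) {F : V →ₗ[R] X} {p : Submodule R X}
    (h : ∀ i, F (b i) ∈ p) (x : V) : F x ∈ p := by
  have : Submodule.span R (Set.range b) ≤ p.comap F :=
    Submodule.span_le.2 (by rintro _ ⟨i, rfl⟩; exact h i)
  exact this (by rw [b.span_eq]; trivial)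

theorem approx_mem_of_sub_mem {n : ℕ} (H : ∀ (j : ι) (M : Multiset ι),
      approx b n (b j) (mono K M) - mono K (j ::ₘ M) ∈ degreeLE K ι (card M))
    {d : ℕ} (x : L) {s : Poly K ι} (hs : s ∈ degreeLE K ι d) :
    approx b n x s ∈ degreeLE K ι (d + 1) := by
  refine degreeLE_le (p := (degreeLE K ι (d + 1)).comap (approx b n x)) (fun M hM ↦ ?_) hs
  change (approx b n).flip (mono K M) x ∈ degreeLE K ι (d + 1)
  refine map_mem_of_basis b (fun i ↦ ?_) x
  rw [LinearMap.flip_apply, ← sub_add_cancel (approx b n (b i) (mono K M)) (mono K (i ::ₘ M))]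
  exact add_mem (degreeLE_mono (hM.trans d.le_succ) (H i M))
    (mono_mem_degreeLE (by simpa using hM))

/-- Reordering only creates terms of lower degree. This makes the recursion consistent: the
correction terms stay in the degrees where the approximations agree. -/
theorem approx_sub_mem (n : ℕ) (j : ι) (M : Multiset ι) :
    approx b n (b j) (mono K M) - mono K (j ::ₘ M) ∈ degreeLE K ι (card M) := by
  induction n generalizing j M with
  | zero => simp [approx, Module.Basis.constr_basis]
  | succ n ih =>
    rcases eq_zero_or_exists_min M with rfl | ⟨k, N, rfl, hN⟩
    · rw [approx_lead b _ (by simp), sub_self]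
      exact zero_mem _
    · rcases le_or_gt j k with hjk | hkj
      · rw [approx_lead b _ (by simpa [hjk] using fun i hi ↦ hjk.trans (hN i hi)), sub_self]
        exact zero_mem _
      · rw [approx_step b n hkj hN, add_sub_cancel_left, card_cons]
        exact add_mem (approx_mem_of_sub_mem b ih _ (ih j N))
          (approx_mem_of_sub_mem b ih _ (mono_mem_degreeLE le_rfl))

theorem approx_succ (n : ℕ) (x : L) {s : Poly K ι} (hs : s ∈ degreeLE K ι n) :
    approx b (n + 1) x s = approx b n x s := by
  induction n generalizing x s with
  | zero =>
    refine eqOn_degreeLE (fun M hM ↦ ?_) hs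
    obtain rfl : M = 0 := by simpa using hM
    refine apply_eq_of_basis b (fun j ↦ ?_) x
    rw [approx_lead b _ (by simp),
      approx_lead b _ (by simp)]
  | succ n ih =>
    refine eqOn_degreeLE (fun M hM ↦ ?_) hs
    refine apply_eq_of_basis b (fun j ↦ ?_) x
    rcases eq_zero_or_exists_min M with rfl | ⟨k, N, rfl, hN⟩
    · rw [approx_lead b _ (by simp), approx_lead b _ (by simp)]
    · have hN' : card N ≤ n := by simpa using hM
      rcases le_or_gt j k with hjk | hkj
      · have : ∀ i ∈ k ::ₘ N, j ≤ i := by simpa [hjk] using fun i hi ↦ hjk.trans (hN i hi)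
        rw [approx_lead b _ this, approx_lead b _ this]
      · rw [approx_step b _ hkj hN, approx_step b _ hkj hN, ih _ (mono_mem_degreeLE hN'),
          ih _ (mono_mem_degreeLE hN'),
          ih _ (degreeLE_mono hN' (approx_sub_mem b n j N))]

theorem approx_eq_of_le {d n : ℕ} (h : d ≤ n) (x : L) {s : Poly K ι} (hs : s ∈ degreeLE K ι d) :
    approx b n x s = approx b d x s := by
  induction n, h using Nat.le_induction with
  | base => rfl
  | succ n hn ih => rw [approx_succ b n x (degreeLE_mono hn hs), ih]

/-- The Poincaré–Birkhoff–Witt representation: the action of `L` on the ordered monomials in a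
basis. -/
noncomputable def rep : L →ₗ[K] Poly K ι →ₗ[K] Poly K ι :=
  (lift fun M ↦ (approx b (card M)).flip (mono K M)).flip

theorem rep_eq {d : ℕ} (x : L) {s : Poly K ι} (hs : s ∈ degreeLE K ι d) :
    rep b x s = approx b d x s := by
  refine eqOn_degreeLE (fun M hM ↦ ?_) hs
  rw [approx_eq_of_le b hM x (mono_mem_degreeLE le_rfl)]
  simp [rep]

theorem rep_lead {j : ι} {M : Multiset ι} (h : ∀ i ∈ M, j ≤ i) :
    rep b (b j) (mono K M) = mono K (j ::ₘ M) := by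
  rw [rep_eq b _ (mono_mem_degreeLE le_rfl), approx_lead b _ h]

theorem rep_sub_mem (j : ι) (M : Multiset ι) :
    rep b (b j) (mono K M) - mono K (j ::ₘ M) ∈ degreeLE K ι (card M) := by
  rw [rep_eq b _ (mono_mem_degreeLE le_rfl)]
  exact approx_sub_mem b _ j M

/-- The subtraction in `approx` disappears here: k is minimal, so x_k acts on the monomial j N by
adjoining k, which restores the removed leading term. -/
theorem rep_step {j k : ι} {N : Multiset ι} (hkj : k < j) (h : ∀ i ∈ N, k ≤ i) :
    rep b (b j) (mono K (k ::ₘ N)) =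
      rep b (b k) (rep b (b j) (mono K N)) + rep b ⁅b j, b k⁆ (mono K N) := by
  have hN : mono K N ∈ degreeLE K ι (card N) := mono_mem_degreeLE le_rfl
  have hkN : mono K (k ::ₘ N) ∈ degreeLE K ι (card N + 1) := mono_mem_degreeLE (by simp)
  have hk : rep b (b k) (mono K (j ::ₘ N)) = mono K (j ::ₘ k ::ₘ N) := by
    rw [rep_lead b (by simpa [hkj.le] using h), cons_swap]
  have h' := map_add (rep b (b k)) (rep b (b j) (mono K N) - mono K (j ::ₘ N))
    (mono K (j ::ₘ N))
  rw [sub_add_cancel, hk] at h'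
  rw [h', rep_eq b (b j) hkN, rep_eq b (b k) (rep_sub_mem b j N),
    rep_eq b (b j) hN, rep_eq b _ hN, approx_step b _ hkj h]
  abel

/-- Induction on degree. If the smaller of the two variables is minimal against the monomial, the
relation is `rep_step`. Otherwise the monomial is k N with k below both variables; both are moved
past k, and the relation follows from the one on N and the Jacobi identity. -/
theorem commutator_rep (d : ℕ) (x y : L) {s : Poly K ι} (hs : s ∈ degreeLE K ι d) :
    rep b x (rep b y s) - rep b y (rep b x s) = rep b ⁅x, y⁆ s := by
  induction d using Nat.strong_induction_on generalizing x y s with | _ d ih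
  have ih' : ∀ e < d, ∀ (x y : L) (s : Poly K ι), s ∈ degreeLE K ι e →
      rep b x (rep b y s) =
        rep b y (rep b x s) + rep b ⁅x, y⁆ s :=
    fun e he x y s hs ↦ by rw [← ih e he x y hs]; abel
  suffices H : ∀ M : Multiset ι, card M ≤ d → ∀ i j : ι, j < i →
      rep b (b i) (rep b (b j) (mono K M)) -
        rep b (b j) (rep b (b i) (mono K M)) = rep b ⁅b i, b j⁆ (mono K M) by
    refine eqOn_degreeLE (f := rep b x ∘ₗ rep b y - rep b y ∘ₗ rep b x)
      (fun M hM ↦ ?_) hs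
    let A : L →ₗ[K] L →ₗ[K] Poly K ι := LinearMap.mk₂ K
      (fun x y ↦ rep b x (rep b y (mono K M)))
      (by simp) (by simp) (by simp) (by simp)
    let B : L →ₗ[K] L →ₗ[K] Poly K ι := LinearMap.mk₂ K
      (fun x y ↦ rep b ⁅x, y⁆ (mono K M)) (by simp) (by simp) (by simp) (by simp)
    suffices A - A.flip = B from congr($this x y)
    refine b.ext fun i ↦ b.ext fun j ↦ ?_
    change rep b (b i) (rep b (b j) (mono K M)) -
        rep b (b j) (rep b (b i) (mono K M)) = rep b ⁅b i, b j⁆ (mono K M)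
    rcases lt_trichotomy i j with h | rfl | h
    · rw [← neg_sub, H M hM j i h, ← lie_skew (b i) (b j), map_neg, LinearMap.neg_apply]
    · simp
    · exact H M hM i j h
  intro M hM i j hji
  by_cases hj : ∀ l ∈ M, j ≤ l
  · rw [rep_lead b hj, rep_step b hji hj]
    abel
  · rcases eq_zero_or_exists_min M with rfl | ⟨k, N, rfl, hN⟩
    · simp at hj
    have hkj : k < j := by
      by_contra! h
      exact hj (by simpa [h] using fun i hi ↦ h.trans (hN i hi))
    have hd : card N < d := by simpa using hM
    have hNd : mono K N ∈ degreeLE K ι (card N) := mono_mem_degreeLE le_rfl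
    -- The two middle terms are exchanged by i ↔ j, so they cancel in the commutator.
    have key : ∀ i j : ι, k < i → k < j →
        rep b (b i) (rep b (b j) (mono K (k ::ₘ N))) =
          rep b (b k) (rep b (b i) (rep b (b j) (mono K N))) +
          rep b ⁅b i, b k⁆ (rep b (b j) (mono K N)) +
          rep b ⁅b j, b k⁆ (rep b (b i) (mono K N)) +
          rep b ⁅b i, ⁅b j, b k⁆⁆ (mono K N) := by
      intro i j hi hj
      have h₁ : rep b (b i) (rep b (b k) (rep b (b j) (mono K N))) =
          rep b (b k) (rep b (b i) (rep b (b j) (mono K N))) +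
          rep b ⁅b i, b k⁆ (rep b (b j) (mono K N)) := by
        have hkjN : ∀ l ∈ j ::ₘ N, k ≤ l := by simpa [hj.le] using hN
        -- The vector x_j N may have degree d, out of reach of the induction. Its leading monomial j
        -- N is handled by `rep_step`, since k is minimal there too; only the remainder, of degree
        -- at most that of N, needs the induction hypothesis.
        have h := ih' _ hd (b i) (b k) _ (rep_sub_mem b j N)
        simp only [map_sub] at h
        rw [rep_lead b hkjN, rep_step b hi hkjN] at h
        rw [sub_eq_iff_eq_add] at h
        rw [h]
        abel
      rw [rep_step b hj hN, map_add, h₁, ih' _ hd (b i) ⁅b j, b k⁆ _ hNd]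
      abel
    rw [key i j (hkj.trans hji) hkj, key j i hkj (hkj.trans hji)]
    have h₂ := ih' _ hd (b i) (b j) _ hNd
    have h₃ := ih' _ hd ⁅b i, b j⁆ (b k) _ hNd
    have h₄ : rep b (b k) (mono K N) = mono K (k ::ₘ N) := rep_lead b hN
    rw [h₄, lie_lie, map_sub, LinearMap.sub_apply] at h₃
    rw [h₂, h₃, map_add]
    abel

theorem rep_lie (x y : L) (s : Poly K ι) :
    rep b ⁅x, y⁆ s = rep b x (rep b y s) - rep b y (rep b x s) := by
  obtain ⟨d, hd⟩ := exists_mem_degreeLE s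
  exact (commutator_rep b d x y hd).symm

end LieAlgebra.PBW

/-! ### Freeness over an ideal, the counit, and adapted bases. -/

namespace LieAlgebra.PBW

open Multiset (card card_cons cons_swap)

section Counit

variable {K ι : Type*} [CommRing K]

/-- The coefficient of the empty monomial. -/
noncomputable def counit (K ι : Type*) [CommRing K] : Poly K ι →ₗ[K] K :=
  open Classical in lift fun M ↦ if M = 0 then 1 else 0

@[simp]
theorem counit_mono_zero : counit K ι (mono K 0) = 1 := by
  simp [counit]

@[simp]
theorem counit_mono_cons (k : ι) (N : Multiset ι) : counit K ι (mono K (k ::ₘ N)) = 0 := by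
  simp [counit]

theorem poly_hom_ext {X : Type*} [AddCommGroup X] [Module K X] {f g : Poly K ι →ₗ[K] X}
    (h : ∀ M, f (mono K M) = g (mono K M)) : f = g :=
  (monoBasis K ι).ext h

end Counit

section Ext

variable {K L m ι X : Type*} [CommRing K] [LieRing L] [LieAlgebra K L] [LieRing m]
  [LieAlgebra K m] [LinearOrder ι] [AddCommGroup X] [Module K X]
  (b : Module.Basis ι K L)

/-- The extension of a family of vectors of a module over a subalgebra, indexed by the monomials in
the variables outside `J`, along the actions of the variables in `J`. -/
noncomputable def extendList (J : Set ι) (ρ : m →ₗ[K] X →ₗ[K] X) (c : ι → m)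
    (φ₀ : Multiset ι → X) : List ι → X
  | [] => φ₀ 0
  | k :: l => open Classical in
      if k ∈ J then ρ (c k) (extendList J ρ c φ₀ l) else φ₀ (k ::ₘ (l : Multiset ι))

/-- If an initial segment of the basis of `L` spans the image of `μ : m → L`, then, as an
`m`-module, the Poincaré–Birkhoff–Witt representation of `L` is freely generated, among the modules
on which `ker μ` acts trivially, by the monomials in the other variables. -/
theorem exists_extension {J : Set ι} (hJ : IsLowerSet J) (μ : m →ₗ⁅K⁆ L)
    (hJμ : Submodule.span K (b '' J) = LinearMap.range (μ : m →ₗ[K] L))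
    (ρ : m →ₗ[K] X →ₗ[K] X) (hρ : ∀ a a' x, ρ ⁅a, a'⁆ x = ρ a (ρ a' x) - ρ a' (ρ a x))
    (hμ : ∀ a, μ a = 0 → ρ a = 0) (φ₀ : Multiset ι → X) :
    ∃ φ : Poly K ι →ₗ[K] X, (∀ M : Multiset ι, (∀ i ∈ M, i ∉ J) → φ (mono K M) = φ₀ M) ∧
      ∀ a s, φ (rep b (μ a) s) = ρ a (φ s) := by
  have hc : ∀ i, ∃ a, i ∈ J → μ a = b i := by
    intro i
    by_cases hi : i ∈ J
    · have : b i ∈ LinearMap.range (μ : m →ₗ[K] L) := by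
        rw [← hJμ]
        exact Submodule.subset_span ⟨i, hi, rfl⟩
      exact ⟨this.choose, fun _ ↦ this.choose_spec⟩
    · exact ⟨0, fun h ↦ (hi h).elim⟩
  choose c hc using hc
  let φ : Poly K ι →ₗ[K] X := lift fun M ↦ extendList J ρ c φ₀ (M.sort (· ≤ ·))
  have hφ₀ : ∀ M : Multiset ι, (∀ i ∈ M, i ∉ J) → φ (mono K M) = φ₀ M := by
    intro M hM
    rw [lift_mono]
    rcases eq_zero_or_exists_min M with rfl | ⟨k, N, rfl, hN⟩
    · simp [extendList]
    · rw [Multiset.sort_cons k N (· ≤ ·) hN, extendList, if_neg (hM k (by simp)),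
        Multiset.sort_eq]
  have hφ : ∀ (k : ι) (N : Multiset ι), k ∈ J → (∀ i ∈ N, k ≤ i) →
      φ (mono K (k ::ₘ N)) = ρ (c k) (φ (mono K N)) := by
    intro k N hk hN
    rw [lift_mono, lift_mono, Multiset.sort_cons k N (· ≤ ·) hN, extendList, if_pos hk]
  refine ⟨φ, hφ₀, fun a s ↦ ?_⟩
  obtain ⟨d, hs⟩ := exists_mem_degreeLE s
  induction d using Nat.strong_induction_on generalizing a s with | _ d ih
  refine eqOn_degreeLE (f := φ ∘ₗ rep b (μ a)) (g := ρ a ∘ₗ φ) (fun M hM ↦ ?_) hs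
  -- Variables in J come first in sorted order, so the variable k to be crossed is again in J and φ
  -- is known on both sides; [c j, c k] is a lift of the bracket of the two basis vectors.
  have key : ∀ j ∈ J, φ (rep b (μ (c j)) (mono K M)) = ρ (c j) (φ (mono K M)) := by
    intro j hj
    by_cases hjM : ∀ i ∈ M, j ≤ i
    · rw [hc j hj, rep_lead b hjM, hφ j M hj hjM]
    · rcases eq_zero_or_exists_min M with rfl | ⟨k, N, rfl, hN⟩
      · simp at hjM
      have hkj : k < j := by
        by_contra! h
        exact hjM (by simpa [h] using fun i hi ↦ h.trans (hN i hi))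
      have hk : k ∈ J := hJ hkj.le hj
      have hd : card N < d := by simpa using hM
      have hNd : mono K N ∈ degreeLE K ι (card N) := mono_mem_degreeLE le_rfl
      have h₁ := ih _ hd (c k) _ (rep_sub_mem b j N)
      have hkjN : ∀ l ∈ j ::ₘ N, k ≤ l := by simpa [hkj.le] using hN
      simp only [map_sub] at h₁
      rw [hc k hk, rep_lead b hkjN, hφ k _ hk hkjN, sub_left_inj] at h₁
      have h₂ := ih _ hd ⁅c j, c k⁆ _ hNd
      have h₃ := ih _ hd (c j) _ hNd
      rw [LieHom.map_lie, hc j hj, hc k hk, hρ] at h₂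
      rw [hc j hj] at h₃
      rw [hc j hj, rep_step b hkj hN, map_add, h₁, h₂, h₃, hφ k N hk hN]
      abel
  -- A general element of m differs from a combination of the chosen lifts by an element of `ker μ`,
  -- which acts as zero on both sides.
  have ha : μ a ∈ (Submodule.span K (c '' J)).map (μ : m →ₗ[K] L) := by
    have : μ a ∈ Submodule.span K (b '' J) := by
      rw [hJμ]
      exact ⟨a, rfl⟩
    rw [Submodule.map_span]
    refine Submodule.span_mono ?_ this
    rintro _ ⟨i, hi, rfl⟩
    exact ⟨c i, ⟨i, hi, rfl⟩, hc i hi⟩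
  obtain ⟨a', ha', haa'⟩ := ha
  replace haa' : μ a' = μ a := haa'
  have hker := hμ (a - a') (by rw [map_sub, haa', sub_self])
  rw [map_sub, sub_eq_zero] at hker
  change φ (rep b (μ a) (mono K M)) = ρ a (φ (mono K M))
  rw [← haa', hker]
  clear hker haa'
  induction ha' using Submodule.span_induction with
  | mem _ h =>
    obtain ⟨j, hj, rfl⟩ := h
    exact key j hj
  | zero => simp
  | add x y _ _ hx hy => simp only [map_add, LinearMap.add_apply, hx, hy]
  | smul t x _ hx => simp only [map_smul, LinearMap.smul_apply, hx]

-- The representation is generated by 1, freely, so there is an equivariant map to the trivial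
-- module K with 1 ↦ 1; it kills every nonconstant monomial, hence is the counit.
@[simp]
theorem counit_rep (x : L) (s : Poly K ι) : counit K ι (rep b x s) = 0 := by
  obtain ⟨φ, h₀, hφ⟩ := exists_extension (X := K) b isLowerSet_univ (LieHom.id : L →ₗ⁅K⁆ L)
    (by
      rw [Set.image_univ, b.span_eq]
      exact (LinearMap.range_id).symm) 0 (by simp) (by simp) 1
  have : φ = counit K ι := by
    refine poly_hom_ext fun M ↦ ?_
    rcases eq_zero_or_exists_min M with rfl | ⟨k, N, rfl, hN⟩
    · rw [h₀ _ (by simp)]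
      simp
    · rw [counit_mono_cons, ← rep_lead b hN]
      exact hφ (b k) (mono K N)
  rw [← this]
  exact hφ x s

/-- Uniqueness half of freeness: a leading variable in J can be peeled off by equivariance, and a
sorted monomial whose first variable is outside J has all its variables outside J. -/
theorem eq_of_extension {J : Set ι} (hJ : IsLowerSet J) (μ : m →ₗ⁅K⁆ L)
    (hJμ : Submodule.span K (b '' J) = LinearMap.range (μ : m →ₗ[K] L))
    (ρ : m →ₗ[K] X →ₗ[K] X) {φ ψ : Poly K ι →ₗ[K] X}
    (h₀ : ∀ M : Multiset ι, (∀ i ∈ M, i ∉ J) → φ (mono K M) = ψ (mono K M))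
    (hφ : ∀ a s, φ (rep b (μ a) s) = ρ a (φ s)) (hψ : ∀ a s, ψ (rep b (μ a) s) = ρ a (ψ s)) :
    φ = ψ := by
  refine poly_hom_ext fun M ↦ ?_
  induction h : card M generalizing M with
  | zero =>
    obtain rfl : M = 0 := by simpa using h
    exact h₀ 0 (by simp)
  | succ d ih =>
    rcases eq_zero_or_exists_min M with rfl | ⟨k, N, rfl, hN⟩
    · exact h₀ 0 (by simp)
    · by_cases hk : k ∈ J
      · have : b k ∈ LinearMap.range (μ : m →ₗ[K] L) := by
          rw [← hJμ]
          exact Submodule.subset_span ⟨k, hk, rfl⟩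
        obtain ⟨a, ha⟩ := this
        replace ha : μ a = b k := ha
        rw [← rep_lead b hN, ← ha, hφ, hψ, ih N (by simpa using h)]
      · exact h₀ _ (by simpa [hk] using fun i hi hiJ ↦ hk (hJ (hN i hi) hiJ))

/-- The commutators met on the way to the sorted position vanish. Hence a basis of a central
subspace acts by plain multiplication even if it is not an initial segment. -/
theorem rep_of_central {j : ι} (hj : ∀ x : L, ⁅b j, x⁆ = 0) (M : Multiset ι) :
    rep b (b j) (mono K M) = mono K (j ::ₘ M) := by
  induction h : card M generalizing M with
  | zero =>
    obtain rfl : M = 0 := by simpa using h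
    exact rep_lead b (by simp)
  | succ d ih =>
    by_cases hjM : ∀ i ∈ M, j ≤ i
    · exact rep_lead b hjM
    · rcases eq_zero_or_exists_min M with rfl | ⟨k, N, rfl, hN⟩
      · simp at hjM
      have hkj : k < j := by
        by_contra! h
        exact hjM (by simpa [h] using fun i hi ↦ h.trans (hN i hi))
      rw [rep_step b hkj hN, hj, ih N (by simpa using h),
        rep_lead b (by simpa [hkj.le] using hN), cons_swap]
      simp

end Ext

/-- Every subspace of a vector space is spanned by an initial segment of an ordered basis. -/
theorem exists_ordered_basis.{uK, w} {K : Type uK} {L : Type w} [Field K] [AddCommGroup L]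
    [Module K L] (W : Submodule K L) :
    ∃ (ι : Type w) (_ : LinearOrder ι) (b : Module.Basis ι K L) (J : Set ι),
      IsLowerSet J ∧ Submodule.span K (b '' J) = W := by
  obtain ⟨W', hW⟩ := W.exists_isCompl
  let b₁ := Module.Basis.ofVectorSpace K W
  let b₂ := Module.Basis.ofVectorSpace K W'
  let _ : LinearOrder (Module.Basis.ofVectorSpaceIndex K W) := IsWellOrder.linearOrder WellOrderingRel
  let _ : LinearOrder (Module.Basis.ofVectorSpaceIndex K W') :=
    IsWellOrder.linearOrder WellOrderingRel
  -- The lexicographic sum puts the basis of the subspace below that of the complement.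
  let b := ((b₁.prod b₂).map (Submodule.prodEquivOfIsCompl W W' hW)).reindex toLex
  have hb : ∀ i, b (Sum.inlₗ i) = b₁ i := fun i ↦ by
    simp [b, Sum.inlₗ]
  refine ⟨_, inferInstance, b, Set.range Sum.inlₗ, ?_, ?_⟩
  · rintro _ x hx ⟨i, rfl⟩
    rcases x with x | x
    · exact ⟨x, rfl⟩
    · exact (Sum.Lex.not_inr_le_inl hx).elim
  · rw [← Set.range_comp]
    have : (b ∘ Sum.inlₗ) = W.subtype ∘ b₁ := funext hb
    rw [this, Set.range_comp, ← Submodule.map_span, b₁.span_eq, Submodule.map_top,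
      Submodule.range_subtype]

end LieAlgebra.PBW

/-! ### The coinduced module and the cocycle with values in it. -/

namespace LieCrossedModule

open LieAlgebra.PBW

/-- The conjugation action on linear maps between two representations of a Lie algebra. -/
abbrev conjLieRingModule {K L S Y : Type*} [CommRing K] [LieRing L] [LieAlgebra K L]
    [AddCommGroup S] [Module K S] [AddCommGroup Y] [Module K Y]
    (ρ : L →ₗ[K] S →ₗ[K] S) (hρ : ∀ x y s, ρ ⁅x, y⁆ s = ρ x (ρ y s) - ρ y (ρ x s))
    (κ : L →ₗ[K] Y →ₗ[K] Y) (hκ : ∀ x y s, κ ⁅x, y⁆ s = κ x (κ y s) - κ y (κ x s)) :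
    LieRingModule L (S →ₗ[K] Y) where
  bracket x f := κ x ∘ₗ f - f ∘ₗ ρ x
  add_lie x y f := by ext s; simp; abel
  lie_add x f g := by ext s; simp; abel
  leibniz_lie x y f := by ext s; simp [hρ, hκ]; abel

section

variable {K m n : Type*} [CommRing K] [LieRing m] [LieAlgebra K m] [LieRing n] [LieAlgebra K n]
  (C : LieCrossedModule K m n)

theorem kerAct_lie (x y : n) (v : C.Ker) :
    C.kerAct ⁅x, y⁆ v = C.kerAct x (C.kerAct y v) - C.kerAct y (C.kerAct x v) := by
  apply C.incl_injective
  simp [C.incl_kerAct, LieDerivation.lie_apply]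

theorem lie_incl (a : m) (v : C.Ker) : ⁅a, C.incl v⁆ = 0 := by
  rw [← C.act_map, ← C.incl_kerAct, C.kerAct_map]
  simp

theorem incl_lie (a : m) (v : C.Ker) : ⁅C.incl v, a⁆ = 0 := by
  rw [← lie_skew, lie_incl, neg_zero]

theorem exists_incl_eq {a : m} (h : C.μ a = 0) : ∃ v, C.incl v = a :=
  ⟨⟨a, h⟩, rfl⟩

end

section

variable {K m n : Type*} [Field K] [LieRing m] [LieAlgebra K m] [LieRing n] [LieAlgebra K n]
  (C : LieCrossedModule K m n)

/-- There is a linear map from the Poincaré–Birkhoff–Witt representation of `m` to the central ideal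
`ker μ` that retracts the degree one part and kills the products of `ker μ` with nonconstant
polynomials. -/
theorem exists_retraction {ι : Type*} [LinearOrder ι] (b : Module.Basis ι K m) {J : Set ι}
    (hJ : Submodule.span K (b '' J) = LinearMap.ker (C.μ : m →ₗ[K] n)) :
    ∃ p : Poly K ι →ₗ[K] C.Ker, ∀ v s, p (rep b (C.incl v) s) = counit K ι s • v := by
  classical
  have hβ : ∀ j, ∃ v : C.Ker, j ∈ J → C.incl v = b j := by
    intro j
    by_cases hj : j ∈ J
    · have : b j ∈ LinearMap.ker (C.μ : m →ₗ[K] n) := by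
        rw [← hJ]
        exact Submodule.subset_span ⟨j, hj, rfl⟩
      obtain ⟨v, hv⟩ := C.exists_incl_eq this
      exact ⟨v, fun _ ↦ hv⟩
    · exact ⟨0, fun h ↦ (hj h).elim⟩
  choose β hβ using hβ
  -- The linear part in the variables spanning `ker μ`. Since these are central, v·s has such a part
  -- only from the constant term of s.
  let p : Poly K ι →ₗ[K] C.Ker :=
    lift fun M ↦ if M.card = 1 ∧ ∀ i ∈ M, i ∈ J then (M.map β).sum else 0
  refine ⟨p, fun v s ↦ ?_⟩
  have hv : C.incl v ∈ Submodule.span K (b '' J) := by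
    rw [hJ]
    exact C.map_incl v
  suffices H : ∀ a ∈ Submodule.span K (b '' J), ∀ v, C.incl v = a →
      p ∘ₗ rep b a = (counit K ι).smulRight v from congr($(H _ hv v rfl) s)
  intro a ha
  induction ha using Submodule.span_induction with
  | mem _ h =>
    obtain ⟨j, hj, rfl⟩ := h
    intro v hv
    obtain rfl : v = β j := C.incl_injective (hv.trans (hβ j hj).symm)
    refine poly_hom_ext fun M ↦ ?_
    rw [LinearMap.comp_apply, rep_of_central b (fun x ↦ by rw [← hβ j hj, C.incl_lie]), lift_mono,
      LinearMap.smulRight_apply]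
    rcases eq_zero_or_exists_min M with rfl | ⟨k, N, rfl, hN⟩ <;> simp [hj]
  | zero =>
    intro v hv
    obtain rfl : v = 0 := C.incl_injective (by rw [hv, map_zero])
    ext s
    simp
  | add x y hx hy ihx ihy =>
    intro v hv
    rw [hJ] at hx hy
    obtain ⟨v₁, rfl⟩ := C.exists_incl_eq hx
    obtain ⟨v₂, rfl⟩ := C.exists_incl_eq hy
    obtain rfl : v = v₁ + v₂ := C.incl_injective (by rw [hv, map_add])
    rw [map_add, LinearMap.comp_add, ihx v₁ rfl, ihy v₂ rfl]
    ext s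
    simp
  | smul t x hx ihx =>
    intro v hv
    rw [hJ] at hx
    obtain ⟨v₁, rfl⟩ := C.exists_incl_eq hx
    obtain rfl : v = t • v₁ := C.incl_injective (by rw [hv, map_smul])
    rw [map_smul, LinearMap.comp_smul, ihx v₁ rfl]
    refine LinearMap.ext fun s ↦ ?_
    rw [LinearMap.smul_apply, LinearMap.smulRight_apply, LinearMap.smulRight_apply, smul_comm]

theorem _root_.LinearMap.exists_lift_of_surjective {K S X Y : Type*} [CommRing K]
    [AddCommGroup S] [Module K S] [AddCommGroup X] [Module K X] [AddCommGroup Y] [Module K Y]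
    (q : S →ₗ[K] X) (hq : Function.Surjective q) (f : S →ₗ[K] Y)
    (h : LinearMap.ker q ≤ LinearMap.ker f) : ∃ g : X →ₗ[K] Y, ∀ s, g (q s) = f s :=
  ⟨(LinearMap.ker q).liftQ f h ∘ₗ (q.quotKerEquivOfSurjective hq).symm, fun s ↦ by
    have : (q.quotKerEquivOfSurjective hq).symm (q s) = (LinearMap.ker q).mkQ s := by
      rw [LinearEquiv.symm_apply_eq]
      rfl
    rw [LinearMap.comp_apply, LinearEquiv.coe_coe, this, Submodule.mkQ_apply,
      Submodule.liftQ_apply]⟩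

/-- When D is a 1-cocycle with values in Hom(S, Y), Y a trivial module, this is the corresponding
extension of S by Y; an equivariant section s ↦ (s, q s) means q(a s) = −D(a)(s), so q cobounds D.
-/
theorem exists_shear_rep {K L S Y : Type*} [CommRing K] [AddCommGroup S] [Module K S]
    [AddCommGroup L] [Module K L] [AddCommGroup Y] [Module K Y]
    (r : L →ₗ[K] S →ₗ[K] S) (D : L →ₗ[K] S →ₗ[K] Y) :
    ∃ ρ : L →ₗ[K] (S × Y) →ₗ[K] (S × Y), ∀ a z, ρ a z = (r a z.1, -D a z.1) :=
  ⟨{  toFun a := (r a ∘ₗ LinearMap.fst _ _ _).prod (-(D a ∘ₗ LinearMap.fst _ _ _))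
      map_add' a a' := LinearMap.ext fun z ↦ Prod.ext (by simp) (by simp [add_comm])
      map_smul' t a := LinearMap.ext fun z ↦ Prod.ext (by simp) (by simp) }, fun _ _ ↦ rfl⟩

theorem exists_quotient_rep.{uK, uS, uL} {K : Type uK} {S : Type uS} {L : Type uL} [CommRing K]
    [AddCommGroup S] [Module K S] [AddCommGroup L] [Module K L]
    (r : L →ₗ[K] S →ₗ[K] S) (N : Submodule K S) (hN : ∀ a, N ≤ N.comap (r a)) :
    ∃ (X : Type uS) (_ : AddCommGroup X) (_ : Module K X) (q : S →ₗ[K] X)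
      (ρ : L →ₗ[K] X →ₗ[K] X), Function.Surjective q ∧ LinearMap.ker q = N ∧
      ∀ a s, ρ a (q s) = q (r a s) := by
  refine ⟨S ⧸ N, inferInstance, inferInstance, N.mkQ,
    { toFun a := N.mapQ N (r a) (hN a)
      map_add' a a' := ?_
      map_smul' t a := ?_ }, N.mkQ_surjective, N.ker_mkQ, fun a s ↦ ?_⟩
  · exact Submodule.linearMap_qext _ (LinearMap.ext fun s ↦ by simp)
  · exact Submodule.linearMap_qext _ (LinearMap.ext fun s ↦ by simp)
  · simp

/-- The central extension `m` of the image of `μ` becomes trivial in linear maps from the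
Poincaré–Birkhoff–Witt representation of `n` to `ker μ`. -/
theorem exists_cocycle {ι : Type*} [LinearOrder ι] (b : Module.Basis ι K n) {J : Set ι}
    (hJ : IsLowerSet J)
    (hJμ : Submodule.span K (b '' J) = LinearMap.range (C.μ : m →ₗ[K] n)) :
    ∃ j : m →ₗ[K] Poly K ι →ₗ[K] C.Ker,
      (∀ a a' s, j ⁅a, a'⁆ s = j a (rep b (C.μ a') s) - j a' (rep b (C.μ a) s)) ∧
      ∀ v s, j (C.incl v) s = - counit K ι s • v := by
  classical
  obtain ⟨κ, _, bm, Jm, -, hJm⟩ := exists_ordered_basis (LinearMap.ker (C.μ : m →ₗ[K] n))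
  obtain ⟨p, hp⟩ := C.exists_retraction bm hJm
  -- N is V·U(m), and the quotient X below plays the role of U(im μ).
  obtain ⟨N, hN'⟩ : ∃ N, N = Submodule.span K {t | ∃ v s, rep bm (C.incl v) s = t} := ⟨_, rfl⟩
  have hcomm : ∀ a v s, rep bm a (rep bm (C.incl v) s) = rep bm (C.incl v) (rep bm a s) := by
    intro a v s
    rw [← sub_eq_zero, ← rep_lie, C.lie_incl, map_zero, LinearMap.zero_apply]
  have hN : ∀ a, N ≤ N.comap (rep bm a) := by
    intro a
    rw [hN']
    refine Submodule.span_le.2 ?_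
    rintro _ ⟨v, s, rfl⟩
    exact Submodule.mem_comap.2 (Submodule.subset_span ⟨v, rep bm a s, (hcomm a v s).symm⟩)
  obtain ⟨X, _, _, q, ρ, hq, hqN, hρ⟩ := exists_quotient_rep (rep bm) N hN
  have hqv : ∀ v s, q (rep bm (C.incl v) s) = 0 := by
    intro v s
    rw [← LinearMap.mem_ker, hqN, hN']
    exact Submodule.subset_span ⟨v, s, rfl⟩
  -- T sends the class of s to a ↦ p(a s). It is well defined because V is central: p(a v s) = p(v a
  -- s) = ε(a s) v = 0, with ε the counit.
  obtain ⟨T, hT⟩ := q.exists_lift_of_surjective hq ((rep bm).compr₂ p).flip (by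
    rw [hqN, hN']
    refine Submodule.span_le.2 ?_
    rintro _ ⟨v, s, rfl⟩
    refine LinearMap.mem_ker.2 (LinearMap.ext fun a ↦ ?_)
    rw [LinearMap.flip_apply, LinearMap.compr₂_apply, hcomm, hp, counit_rep, zero_smul,
      LinearMap.zero_apply])
  replace hT : ∀ s a, T (q s) a = p (rep bm a s) := fun s a ↦ by
    rw [hT, LinearMap.flip_apply, LinearMap.compr₂_apply]
  obtain ⟨ε, hε⟩ := q.exists_lift_of_surjective hq (counit K κ) (by
    rw [hqN, hN']
    refine Submodule.span_le.2 ?_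
    rintro _ ⟨v, s, rfl⟩
    exact LinearMap.mem_ker.2 (counit_rep bm _ s))
  obtain ⟨φ, hφ₀, hφ⟩ := exists_extension b hJ C.μ hJμ ρ
    (fun a a' x ↦ by
      obtain ⟨s, rfl⟩ := hq x
      simp only [hρ, rep_lie, map_sub])
    (fun a ha ↦ by
      obtain ⟨v, rfl⟩ := C.exists_incl_eq ha
      refine LinearMap.ext fun x ↦ ?_
      obtain ⟨s, rfl⟩ := hq x
      rw [hρ]
      exact hqv v s)
    -- An equivariant projection U(n) → U(im μ): the free generator 1 goes to 1, the others to 0.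
    (fun M ↦ if M = 0 then q (mono K 0) else 0)
  have hεφ : ε ∘ₗ φ = counit K ι := by
    refine eq_of_extension b hJ C.μ hJμ 0 (fun M hM ↦ ?_) (fun a s ↦ ?_) (by simp)
    · rw [LinearMap.comp_apply, hφ₀ M hM]
      by_cases h : M = 0
      · rw [if_pos h, h, hε, counit_mono_zero, counit_mono_zero]
      · rw [if_neg h, map_zero, counit, lift_mono, if_neg h]
    · rw [LinearMap.comp_apply, hφ]
      obtain ⟨t, ht⟩ := hq (φ s)
      rw [← ht, hρ, hε, counit_rep, LinearMap.zero_apply, LinearMap.zero_apply]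
  -- Thus j(a)(s) = −p(a t) for any t in U(m) representing φ(s); the cocycle rule is [a, a'] t = a
  -- a' t − a' a t.
  refine ⟨-(T ∘ₗ φ).flip, fun a a' s ↦ ?_, fun v s ↦ ?_⟩
  · simp only [LinearMap.neg_apply, LinearMap.flip_apply, LinearMap.comp_apply, hφ]
    obtain ⟨t, ht⟩ := hq (φ s)
    rw [← ht]
    simp only [hρ, hT, rep_lie, map_sub]
    abel
  · rw [LinearMap.neg_apply, LinearMap.neg_apply, LinearMap.flip_apply, ← hεφ,
      LinearMap.comp_apply, LinearMap.comp_apply]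
    obtain ⟨t, ht⟩ := hq (φ s)
    rw [← ht, hT, hε, hp, neg_smul]

end

/-- There is an `n`-module `Q` with a 1-cocycle `j` of `m` that is injective on `ker μ` and
`n`-equivariant up to coboundaries. -/
theorem exists_splitting_module.{uK, w} {K : Type uK} {m n : Type w} [Field K] [LieRing m]
    [LieAlgebra K m] [LieRing n] [LieAlgebra K n] (C : LieCrossedModule K m n) :
    ∃ (Q : Type (max uK w)) (_ : AddCommGroup Q) (_ : Module K Q) (_ : LieRingModule n Q)
      (_ : LieModule K n Q) (j : m →ₗ[K] Q),
      (∀ a a', j ⁅a, a'⁆ = ⁅C.μ a, j a'⁆ - ⁅C.μ a', j a⁆) ∧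
      (∀ v, j (C.incl v) = 0 → v = 0) ∧
      ∀ x, ∃ q, ∀ a, ⁅x, j a⁆ - j (C.act x a) = ⁅C.μ a, q⁆ := by
  obtain ⟨ι, _, b, J, hJ, hJμ⟩ := exists_ordered_basis (LinearMap.range (C.μ : m →ₗ[K] n))
  obtain ⟨j, hj, hjv⟩ := C.exists_cocycle b hJ hJμ
  let _ : LieRingModule n (Poly K ι →ₗ[K] C.Ker) :=
    conjLieRingModule (rep b) (rep_lie b) C.kerAct C.kerAct_lie
  have hlie : ∀ (x : n) (f : Poly K ι →ₗ[K] C.Ker) (s : Poly K ι),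
      ⁅x, f⁆ s = C.kerAct x (f s) - f (rep b x s) := fun _ _ _ ↦ rfl
  have _ : LieModule K n (Poly K ι →ₗ[K] C.Ker) :=
    { smul_lie t x f := by ext s; simp [hlie, smul_sub]
      lie_smul t x f := by ext s; simp [hlie, smul_sub] }
  have hj' : ∀ a a', j ⁅a, a'⁆ = ⁅C.μ a, j a'⁆ - ⁅C.μ a', j a⁆ := by
    intro a a'
    ext s
    rw [hj, LinearMap.sub_apply, hlie, hlie, C.kerAct_map, C.kerAct_map, LinearMap.zero_apply,
      LinearMap.zero_apply]
    abel
  refine ⟨Poly K ι →ₗ[K] C.Ker, inferInstance, inferInstance, inferInstance, inferInstance, j, hj',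
    fun v hv ↦ ?_, fun x ↦ ?_⟩
  · have := hjv v (mono K 0)
    rw [hv] at this
    simpa using this.symm
  · obtain ⟨D, hD⟩ : ∃ D : m →ₗ[K] Poly K ι →ₗ[K] C.Ker,
        ∀ a, D a = ⁅x, j a⁆ - j (C.act x a) := ⟨
      { toFun a := ⁅x, j a⁆ - j (C.act x a)
        map_add' a a' := by simp; abel
        map_smul' t a := by simp [smul_sub] }, fun _ ↦ rfl⟩
    have hDlie : ∀ a a', D ⁅a, a'⁆ = ⁅C.μ a, D a'⁆ - ⁅C.μ a', D a⁆ := by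
      intro a a'
      simp only [hD, LieDerivation.apply_lie_eq_add, map_add, hj', C.map_act, lie_sub, lie_lie]
      abel
    have hDv : ∀ v, D (C.incl v) = 0 := by
      intro v
      ext s
      rw [hD, ← C.incl_kerAct, LinearMap.sub_apply, hlie, hjv, hjv, hjv, counit_rep]
      simp
    obtain ⟨ρ, hρ⟩ := exists_shear_rep ((rep b).comp (C.μ : m →ₗ[K] n)) D
    replace hρ : ∀ a z, ρ a z = (rep b (C.μ a) z.1, -D a z.1) := hρ
    obtain ⟨φ, hφ₀, hφ⟩ := exists_extension b hJ C.μ hJμ ρ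
      (fun a a' z ↦ by
        rw [hρ, hDlie]
        simp only [LinearMap.sub_apply, hlie, C.kerAct_map, hρ, LieHom.map_lie, rep_lie,
          LinearMap.zero_apply]
        refine Prod.ext rfl ?_
        simp only [Prod.snd_sub]
        abel)
      (fun a ha ↦ by
        obtain ⟨v, rfl⟩ := C.exists_incl_eq ha
        refine LinearMap.ext fun z ↦ ?_
        rw [hρ, ha, hDv]
        simp)
      (fun M ↦ (mono K M, 0))
    have hfst : LinearMap.fst _ _ _ ∘ₗ φ = LinearMap.id :=
      eq_of_extension b hJ C.μ hJμ ((rep b).comp (C.μ : m →ₗ[K] n))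
        (fun M hM ↦ by rw [LinearMap.comp_apply, hφ₀ M hM]; rfl)
        (fun a s ↦ by rw [LinearMap.comp_apply, hφ, hρ]; rfl) (fun _ _ ↦ rfl)
    -- Since im μ acts trivially on V, μ(a)·q is s ↦ −q(μ(a) s), which the sheared action makes
    -- equal to D(a).
    refine ⟨LinearMap.snd _ _ _ ∘ₗ φ, fun a ↦ ?_⟩
    rw [← hD]
    ext s
    rw [hlie, C.kerAct_map, LinearMap.comp_apply, LinearMap.comp_apply, hφ, hρ]
    have : (φ s).1 = s := congr($hfst s)
    simp [this]

end LieCrossedModule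

/-! ### Invariants, splittings and the resulting 2-cocycle on the cokernel. -/

namespace LieCrossedModule

section Invariants

variable {K m n : Type*} [CommRing K] [LieRing m] [LieAlgebra K m] [LieRing n] [LieAlgebra K n]
  (C : LieCrossedModule K m n)
  (Q : Type*) [AddCommGroup Q] [Module K Q] [LieRingModule n Q] [LieModule K n Q]

/-- The submodule of the elements of an `n`-module on which the image of `μ` acts trivially. -/
def invariants : Submodule K Q where
  carrier := {q | ∀ a, ⁅C.μ a, q⁆ = 0}
  add_mem' {p q} hp hq a := by rw [lie_add, hp, hq, add_zero]
  zero_mem' a := lie_zero _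
  smul_mem' t q hq a := by rw [lie_smul, hq, smul_zero]

theorem lie_mem_invariants (x : n) {q : Q} (hq : q ∈ C.invariants Q) :
    ⁅x, q⁆ ∈ C.invariants Q := by
  intro a
  rw [leibniz_lie, ← lie_skew, neg_lie, ← C.map_act, hq, hq, lie_zero, neg_zero, add_zero]

/-- The action of `n` on the invariants. -/
def invariantsAct : n →ₗ[K] C.invariants Q →ₗ[K] C.invariants Q :=
  LinearMap.mk₂ K (fun x q ↦ ⟨⁅x, (q : Q)⁆, C.lie_mem_invariants Q x q.2⟩)
    (fun x y q ↦ Subtype.ext (add_lie x y (q : Q)))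
    (fun t x q ↦ Subtype.ext (smul_lie t x (q : Q)))
    (fun x p q ↦ Subtype.ext (lie_add x (p : Q) (q : Q)))
    (fun t x q ↦ Subtype.ext (lie_smul t x (q : Q)))

/-- The action of `coker μ` on the invariants. -/
def invariantsCokerAct : C.Coker →ₗ[K] C.invariants Q →ₗ[K] C.invariants Q :=
  (C.imageIdeal : Submodule K n).liftQ (C.invariantsAct Q) (by
    rintro _ ⟨a, rfl⟩
    exact LinearMap.ext fun q ↦ Subtype.ext (q.2 a))

theorem coe_invariantsCokerAct_proj (x : n) (q : C.invariants Q) :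
    (C.invariantsCokerAct Q (C.proj x) q : Q) = ⁅x, (q : Q)⁆ := rfl

instance : LieRingModule C.Coker (C.invariants Q) where
  bracket x q := C.invariantsCokerAct Q x q
  add_lie x y q := by simp
  lie_add x p q := by simp
  leibniz_lie x y q := by
    obtain ⟨x, rfl⟩ := C.proj_surjective x
    obtain ⟨y, rfl⟩ := C.proj_surjective y
    apply Subtype.ext
    rw [← LieHom.map_lie]
    simp only [Submodule.coe_add, coe_invariantsCokerAct_proj]
    exact leibniz_lie x y (q : Q)

theorem coe_proj_lie (x : n) (q : C.invariants Q) :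
    ((⁅C.proj x, q⁆ : C.invariants Q) : Q) = ⁅x, (q : Q)⁆ := rfl

instance : LieModule K C.Coker (C.invariants Q) where
  smul_lie t x q := by
    change C.invariantsCokerAct Q (t • x) q = t • C.invariantsCokerAct Q x q
    simp
  lie_smul t x q := by
    change C.invariantsCokerAct Q x (t • q) = t • C.invariantsCokerAct Q x q
    simp

end Invariants

/-- A splitting of a crossed module `μ : m → n` in an `n`-module `Q`: a 1-cocycle `j` of `m` and a
linear map `J` on `n` that makes `j` equivariant up to coboundaries. -/
structure Splitting {K m n : Type*} [CommRing K] [LieRing m] [LieAlgebra K m] [LieRing n]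
    [LieAlgebra K n] (C : LieCrossedModule K m n)
    (Q : Type*) [AddCommGroup Q] [Module K Q] [LieRingModule n Q] [LieModule K n Q] where
  j : m →ₗ[K] Q
  J : n →ₗ[K] Q
  j_lie : ∀ a a', j ⁅a, a'⁆ = ⁅C.μ a, j a'⁆ - ⁅C.μ a', j a⁆
  j_incl : ∀ v, j (C.incl v) = 0 → v = 0
  lie_J : ∀ x a, ⁅C.μ a, J x⁆ = ⁅x, j a⁆ - j (C.act x a)
  J_map : ∀ a, ∃ v, J (C.μ a) = j a + j (C.incl v)

theorem nonempty_splitting {K m n : Type*} [Field K] [LieRing m] [LieAlgebra K m]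
    [LieRing n] [LieAlgebra K n] (C : LieCrossedModule K m n)
    (Q : Type*) [AddCommGroup Q] [Module K Q] [LieRingModule n Q] [LieModule K n Q]
    (j : m →ₗ[K] Q) (hj : ∀ a a', j ⁅a, a'⁆ = ⁅C.μ a, j a'⁆ - ⁅C.μ a', j a⁆)
    (hv : ∀ v, j (C.incl v) = 0 → v = 0)
    (hx : ∀ x, ∃ q, ∀ a, ⁅x, j a⁆ - j (C.act x a) = ⁅C.μ a, q⁆) : Nonempty (C.Splitting Q) := by
  -- Admissible pairs (x, q). It projects onto n by hypothesis and contains every (μ(a), j(a)) by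
  -- the cocycle rule.
  let E : Submodule K (n × Q) :=
    { carrier := {z | ∀ a, ⁅C.μ a, z.2⁆ = ⁅z.1, j a⁆ - j (C.act z.1 a)}
      add_mem' {y z} hy hz a := by
        simp only [Prod.snd_add, Prod.fst_add, lie_add, add_lie, hy a, hz a, map_add,
          LieDerivation.add_apply]
        abel
      zero_mem' a := by simp
      smul_mem' t z hz a := by simp [hz a, smul_sub] }
  have hE : ∀ z : n × Q, z ∈ E ↔ ∀ a, ⁅C.μ a, z.2⁆ = ⁅z.1, j a⁆ - j (C.act z.1 a) :=
    fun _ ↦ Iff.rfl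
  have hmE : ∀ a, (C.μ a, j a) ∈ E := fun a ↦ (hE _).2 fun a' ↦ by
    rw [C.act_map, hj]
    abel
  obtain ⟨s, hs⟩ := (LinearMap.fst K n Q ∘ₗ E.subtype).exists_rightInverse_of_surjective
    (LinearMap.range_eq_top.2 fun x ↦ by
      obtain ⟨q, hq⟩ := hx x
      exact ⟨⟨(x, q), (hE _).2 fun a ↦ (hq a).symm⟩, rfl⟩)
  obtain ⟨g, hg⟩ := (C.μ : m →ₗ[K] n).rangeRestrict.exists_rightInverse_of_surjective
    (LinearMap.range_rangeRestrict _)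
  obtain ⟨τ, hτ⟩ := g.exists_extend
  have hs' : ∀ x, (s x : n × Q).1 = x := fun x ↦ congr($hs x)
  have hτ' : ∀ a, C.μ (τ (C.μ a)) = C.μ a := by
    intro a
    have h₁ : τ (C.μ a) = g ((C.μ : m →ₗ[K] n).rangeRestrict a) :=
      congr($hτ ((C.μ : m →ₗ[K] n).rangeRestrict a))
    rw [h₁]
    exact congr(($hg ((C.μ : m →ₗ[K] n).rangeRestrict a) : n))
  let J₀ : n →ₗ[K] Q := LinearMap.snd K n Q ∘ₗ E.subtype ∘ₗ s
  have hJ₀ : ∀ x, (x, J₀ x) ∈ E := fun x ↦ by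
    have : ((s x : n × Q).1, J₀ x) ∈ E := (s x).2
    rwa [hs'] at this
  -- With τ satisfying μ τ μ = μ, an arbitrary choice J₀ is kept on x − μ τ x and replaced by j ∘ τ
  -- on μ τ x. So J(μ(a)) = j(τ μ a), and τ μ a − a lies in `ker μ`.
  let J : n →ₗ[K] Q := J₀ - J₀ ∘ₗ (C.μ : m →ₗ[K] n) ∘ₗ τ + j ∘ₗ τ
  have hJ : ∀ x, J x = J₀ (x - C.μ (τ x)) + j (τ x) := fun x ↦ by
    rw [map_sub]
    rfl
  refine ⟨⟨j, J, hj, hv, fun x a ↦ ?_, fun a ↦ ?_⟩⟩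
  · have := E.add_mem (hJ₀ (x - C.μ (τ x))) (hmE (τ x))
    rw [Prod.mk_add_mk, sub_add_cancel, ← hJ] at this
    exact this a
  · obtain ⟨v, hv⟩ := C.exists_incl_eq (a := τ (C.μ a) - a) (by rw [map_sub, hτ', sub_self])
    refine ⟨v, ?_⟩
    rw [hv, hJ, hτ', sub_self, map_zero, map_sub]
    abel

namespace Splitting

open LieModule.Cohomology

variable {K m n : Type*} [CommRing K] [LieRing m] [LieAlgebra K m] [LieRing n] [LieAlgebra K n]
  {C : LieCrossedModule K m n}
  {Q : Type*} [AddCommGroup Q] [Module K Q] [LieRingModule n Q] [LieModule K n Q]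
  (S : C.Splitting Q)

theorem lie_j_incl (x : n) (v : C.Ker) : ⁅x, S.j (C.incl v)⁆ = S.j (C.incl ⁅C.proj x, v⁆) := by
  have := S.lie_J x (C.incl v)
  rw [C.map_incl, zero_lie, eq_comm, sub_eq_zero] at this
  exact this

theorem j_incl_mem (v : C.Ker) : S.j (C.incl v) ∈ C.invariants Q := by
  intro a
  have := S.j_lie a (C.incl v)
  rw [C.lie_incl, C.map_incl, zero_lie, sub_zero, map_zero] at this
  exact this.symm

/-- The embedding of `ker μ` into the invariants. -/
def kerHom : C.Ker →ₗ⁅K, C.Coker⁆ C.invariants Q where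
  -- The sign makes (v, −j(v)) the kernel of (a, q) ↦ (μ(a), j(a) + q).
  toFun v := ⟨-S.j (C.incl v), neg_mem (S.j_incl_mem v)⟩
  map_add' v w := Subtype.ext (by simp [add_comm])
  map_smul' t v := Subtype.ext (by simp)
  map_lie' {x v} := by
    obtain ⟨x, rfl⟩ := C.proj_surjective x
    apply Subtype.ext
    rw [C.coe_proj_lie, lie_neg, S.lie_j_incl]

theorem coe_kerHom (v : C.Ker) : (S.kerHom v : Q) = -S.j (C.incl v) := rfl

theorem kerHom_injective : Function.Injective S.kerHom := by
  refine (injective_iff_map_eq_zero _).2 fun v hv ↦ S.j_incl v ?_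
  rw [← neg_eq_zero, ← coe_kerHom, hv]
  rfl

/-- The quotient of the invariants by `ker μ`. -/
abbrev Quot : Type _ := C.invariants Q ⧸ S.kerHom.range

/-- The projection from the invariants to their quotient by `ker μ`. -/
abbrev quotMk : C.invariants Q →ₗ⁅K, C.Coker⁆ S.Quot := LieSubmodule.Quotient.mk' S.kerHom.range

theorem quotMk_eq_zero {q : C.invariants Q} : S.quotMk q = 0 ↔ ∃ v, S.kerHom v = q := by
  rw [LieSubmodule.Quotient.mk'_apply, LieSubmodule.Quotient.mk_eq_zero']
  exact LieModuleHom.mem_range _ _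

theorem quotMk_surjective : Function.Surjective S.quotMk := LieSubmodule.Quotient.surjective_mk' _

/-- Applying μ(a) to x·J(y) gives x·y·j(a), j(y·x·a) and terms symmetric in x and y.
Antisymmetrising leaves the defect of j at [x, y], which is μ(a)·J([x, y]). -/
theorem d₁₂_mem (x y : n) : d₁₂ K n Q S.J x y ∈ C.invariants Q := by
  intro a
  have h : ∀ x y, ⁅C.μ a, ⁅x, S.J y⁆⁆ =
      ⁅x, ⁅y, S.j a⁆⁆ - ⁅x, S.j (C.act y a)⁆ - ⁅y, S.j (C.act x a)⁆ + S.j (C.act y (C.act x a)) := by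
    intro x y
    rw [leibniz_lie, ← lie_skew, neg_lie, ← C.map_act, S.lie_J, S.lie_J, lie_sub]
    abel
  rw [d₁₂_apply_apply, lie_sub, lie_sub, h, h, S.lie_J, lie_lie, LieHom.map_lie,
    LieDerivation.lie_apply, map_sub]
  abel

/-- The coboundary of `J`, with values in the invariants. -/
def curvature : n →ₗ[K] n →ₗ[K] C.invariants Q :=
  LinearMap.mk₂ K (fun x y ↦ ⟨d₁₂ K n Q S.J x y, S.d₁₂_mem x y⟩)
    (fun x y z ↦ Subtype.ext (by simp))
    (fun t x y ↦ Subtype.ext (by simp [smul_sub]))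
    (fun x y z ↦ Subtype.ext (by simp; abel))
    (fun t x y ↦ Subtype.ext (by simp [smul_sub]))

theorem coe_curvature (x y : n) :
    (S.curvature x y : Q) = ⁅x, S.J y⁆ - ⁅y, S.J x⁆ - S.J ⁅x, y⁆ := rfl

theorem curvature_self (x : n) : S.curvature x x = 0 :=
  Subtype.ext (by rw [coe_curvature]; simp)

theorem curvature_swap (x y : n) : S.curvature x y = -S.curvature y x :=
  Subtype.ext (by
    rw [Submodule.coe_neg, coe_curvature, coe_curvature, ← lie_skew, map_neg]
    abel)

/-- If J were equal to j on im μ, the coboundary would vanish here by `lie_J`. The actual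
discrepancy lies in j(V), which the quotient kills. -/
theorem quotMk_curvature_map (x : n) (a : m) : S.quotMk (S.curvature x (C.μ a)) = 0 := by
  rw [quotMk_eq_zero]
  obtain ⟨v, hv⟩ := S.J_map a
  obtain ⟨w, hw⟩ := S.J_map (C.act x a)
  refine ⟨w - ⁅C.proj x, v⁆, Subtype.ext ?_⟩
  rw [coe_curvature, coe_kerHom, ← C.map_act, hv, hw, S.lie_J, lie_add, S.lie_j_incl, map_sub,
    map_sub]
  abel

theorem quotMk_curvature_map_left (a : m) (x : n) : S.quotMk (S.curvature (C.μ a) x) = 0 := by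
  rw [curvature_swap, map_neg, quotMk_curvature_map, neg_zero]

theorem quotMk_curvature_congr {x x' y y' : n} (hx : C.proj x = C.proj x')
    (hy : C.proj y = C.proj y') : S.quotMk (S.curvature x y) = S.quotMk (S.curvature x' y') := by
  rw [← sub_eq_zero, ← map_sub, C.proj_eq_zero] at hx hy
  obtain ⟨a, ha⟩ := hx
  obtain ⟨b, hb⟩ := hy
  have hx' : x = C.μ a + x' := by rw [ha, sub_add_cancel]
  have hy' : y = C.μ b + y' := by rw [hb, sub_add_cancel]
  rw [hx', hy', map_add, map_add S.quotMk, quotMk_curvature_map, map_add S.curvature,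
    LinearMap.add_apply, map_add S.quotMk, quotMk_curvature_map_left, zero_add, zero_add]

/-- Modulo V the coboundary of J depends only on classes in the cokernel, so a linear section serves
to define α without affecting its values. Closedness is d ∘ d = 0 for cochains of n in Q. -/
theorem exists_twoCocycle
    (hs : ∃ s : C.Coker →ₗ[K] n, (C.proj : n →ₗ[K] C.Coker) ∘ₗ s = LinearMap.id) :
    ∃ α : twoCocycle K C.Coker S.Quot,
      ∀ x y, (α : C.Coker →ₗ[K] C.Coker →ₗ[K] S.Quot) (C.proj x) (C.proj y) =
        S.quotMk (S.curvature x y) := by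
  obtain ⟨s, hs⟩ := hs
  replace hs : ∀ ξ, C.proj (s ξ) = ξ := fun ξ ↦ congr($hs ξ)
  let α : twoCochain K C.Coker S.Quot :=
    ⟨((S.curvature.compl₁₂ s s).compr₂ (S.quotMk : C.invariants Q →ₗ[K] S.Quot)), fun ξ ↦ by
      change S.quotMk (S.curvature (s ξ) (s ξ)) = 0
      rw [S.curvature_self, map_zero]⟩
  have hα : ∀ x y, α (C.proj x) (C.proj y) = S.quotMk (S.curvature x y) := fun x y ↦
    S.quotMk_curvature_congr (hs _) (hs _)
  refine ⟨⟨α, (mem_twoCocycle_iff ..).2 ?_⟩, hα⟩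
  refine LinearMap.ext fun x ↦ LinearMap.ext fun y ↦ LinearMap.ext fun z ↦ ?_
  obtain ⟨x, rfl⟩ := C.proj_surjective x
  obtain ⟨y, rfl⟩ := C.proj_surjective y
  obtain ⟨z, rfl⟩ := C.proj_surjective z
  rw [d₂₃_apply, LinearMap.zero_apply, LinearMap.zero_apply, LinearMap.zero_apply]
  simp only [← LieHom.map_lie, hα, ← LieModuleHom.map_lie, ← map_sub, ← map_add]
  convert map_zero S.quotMk using 2
  apply Subtype.ext
  exact congr($(d₂₃_comp_d₁₂ K n Q) S.J x y z)

end Splitting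

end LieCrossedModule

/-! ### The crossed module over both, and the two morphisms out of it. -/

namespace LieCrossedModule.Splitting

open LieModule.Cohomology

section

variable {K m n : Type*} [CommRing K] [LieRing m] [LieAlgebra K m] [LieRing n] [LieAlgebra K n]
  {C : LieCrossedModule K m n}
  {Q : Type*} [AddCommGroup Q] [Module K Q] [LieRingModule n Q] [LieModule K n Q]
  (S : C.Splitting Q)

open LieAlgebra.SemiDirectSum in
/-- The extension of `n` by the invariants that contains `m`: the stabilizer of `j` in the
semi-direct sum of `n` and `Q`. -/
def extension : LieSubalgebra K (AbelianLie Q ⋊⁅spliceAct K n Q⁆ n) where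
  carrier := {z | ∀ a, ⁅C.μ a, (AbelianLie.of K Q).symm z.left⁆ =
    ⁅z.right, S.j a⁆ - S.j (C.act z.right a)}
  add_mem' {y z} hy hz a := by
    simp only [add_eq_mk, map_add, lie_add, add_lie, LieDerivation.add_apply]
    rw [hy a, hz a]
    abel
  zero_mem' a := by simp
  smul_mem' t z hz a := by
    simp only [smul_eq_mk, map_smul, lie_smul, smul_lie, LieDerivation.smul_apply]
    rw [hz a, smul_sub]
  lie_mem' {y z} hy hz a := by
    have h : ∀ y z : AbelianLie Q ⋊⁅spliceAct K n Q⁆ n,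
        (∀ a, ⁅C.μ a, (AbelianLie.of K Q).symm y.left⁆ =
          ⁅y.right, S.j a⁆ - S.j (C.act y.right a)) →
        (∀ a, ⁅C.μ a, (AbelianLie.of K Q).symm z.left⁆ =
          ⁅z.right, S.j a⁆ - S.j (C.act z.right a)) →
        ⁅C.μ a, ⁅y.right, (AbelianLie.of K Q).symm z.left⁆⁆ =
          ⁅y.right, ⁅z.right, S.j a⁆⁆ - ⁅y.right, S.j (C.act z.right a)⁆ -
            ⁅z.right, S.j (C.act y.right a)⁆ + S.j (C.act z.right (C.act y.right a)) := by
      intro y z hy hz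
      rw [leibniz_lie, ← lie_skew, neg_lie, ← C.map_act, hz, hz, lie_sub]
      abel
    have e : (AbelianLie.of K Q).symm ⁅y, z⁆.left =
        ⁅y.right, (AbelianLie.of K Q).symm z.left⁆ - ⁅z.right, (AbelianLie.of K Q).symm y.left⁆ := by
      rw [lie_eq_mk, AbelianLie.lie_eq_zero, zero_add, map_sub]
      rfl
    have e' : ⁅y, z⁆.right = ⁅y.right, z.right⁆ := rfl
    rw [e, e', lie_sub, h y z hy hz, h z y hz hy, lie_lie, LieHom.map_lie,
      LieDerivation.lie_apply, map_sub]
    abel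

/-- The component in `Q`. -/
def extensionLeft : S.extension →ₗ[K] Q where
  toFun z := (AbelianLie.of K Q).symm z.1.left
  map_add' _ _ := rfl
  map_smul' _ _ := rfl

/-- The projection to `n`. -/
def extensionProj : S.extension →ₗ⁅K⁆ n where
  toFun z := z.1.right
  map_add' _ _ := rfl
  map_smul' _ _ := rfl
  map_lie' := rfl

/-- An element of the extension. -/
def extensionMk (x : n) (q : Q) (h : ∀ a, ⁅C.μ a, q⁆ = ⁅x, S.j a⁆ - S.j (C.act x a)) :
    S.extension :=
  ⟨⟨AbelianLie.of K Q q, x⟩, h⟩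

theorem extension_lie_left (z : S.extension) (a : m) :
    ⁅C.μ a, S.extensionLeft z⁆ =
      ⁅S.extensionProj z, S.j a⁆ - S.j (C.act (S.extensionProj z) a) :=
  z.2 a

theorem extensionLeft_lie (y z : S.extension) :
    S.extensionLeft ⁅y, z⁆ = ⁅S.extensionProj y, S.extensionLeft z⁆ -
      ⁅S.extensionProj z, S.extensionLeft y⁆ := by
  change (AbelianLie.of K Q).symm (⁅y.1.left, z.1.left⁆ + _ - _) = _
  rw [AbelianLie.lie_eq_zero, zero_add, map_sub]
  rfl

theorem extension_ext {y z : S.extension} (h₁ : S.extensionProj y = S.extensionProj z)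
    (h₂ : S.extensionLeft y = S.extensionLeft z) : y = z :=
  Subtype.ext (LieAlgebra.SemiDirectSum.ext ((AbelianLie.of K Q).symm.injective h₂) h₁)

theorem extension_mk_mem (a : m) (q : C.invariants Q) (a' : m) :
    ⁅C.μ a', S.j a + (q : Q)⁆ = ⁅C.μ a, S.j a'⁆ - S.j (C.act (C.μ a) a') := by
  rw [lie_add, q.2, C.act_map, S.j_lie]
  abel

/-- The map from the product of `m` and the invariants to the extension. -/
def spanMap : m × AbelianLie (C.invariants Q) →ₗ⁅K⁆ S.extension where
  toFun z := S.extensionMk (C.μ z.1) (S.j z.1 + ((AbelianLie.of K _).symm z.2 : C.invariants Q))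
    (S.extension_mk_mem _ _)
  map_add' y z := S.extension_ext (map_add C.μ _ _) (by
    change S.j (y.1 + z.1) + (((AbelianLie.of K _).symm (y.2 + z.2) : C.invariants Q) : Q) =
      (S.j y.1 + (((AbelianLie.of K _).symm y.2 : C.invariants Q) : Q)) +
      (S.j z.1 + (((AbelianLie.of K _).symm z.2 : C.invariants Q) : Q))
    rw [map_add, map_add, Submodule.coe_add]
    abel)
  map_smul' t z := S.extension_ext (map_smul C.μ _ _) (by
    change S.j (t • z.1) + (((AbelianLie.of K _).symm (t • z.2) : C.invariants Q) : Q) =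
      t • (S.j z.1 + (((AbelianLie.of K _).symm z.2 : C.invariants Q) : Q))
    rw [map_smul, map_smul, Submodule.coe_smul, smul_add])
  map_lie' {y z} := S.extension_ext (LieHom.map_lie C.μ _ _) (by
    rw [extensionLeft_lie]
    change S.j ⁅y.1, z.1⁆ + (((AbelianLie.of K _).symm ⁅y.2, z.2⁆ : C.invariants Q) : Q) =
      ⁅C.μ y.1, S.j z.1 + (((AbelianLie.of K _).symm z.2 : C.invariants Q) : Q)⁆ -
      ⁅C.μ z.1, S.j y.1 + (((AbelianLie.of K _).symm y.2 : C.invariants Q) : Q)⁆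
    rw [AbelianLie.lie_eq_zero, map_zero, Submodule.coe_zero, add_zero, lie_add, lie_add,
      Subtype.prop ((AbelianLie.of K _).symm z.2), Subtype.prop ((AbelianLie.of K _).symm y.2),
      add_zero, add_zero, S.j_lie])

theorem extensionProj_spanMap (z : m × AbelianLie (C.invariants Q)) :
    S.extensionProj (S.spanMap z) = C.μ z.1 := rfl

theorem extensionLeft_spanMap (a : m) (q : C.invariants Q) :
    S.extensionLeft (S.spanMap (a, AbelianLie.of K _ q)) = S.j a + q := rfl

/-- The derivation of a product of Lie algebras given by derivations of the factors. -/
def _root_.LieDerivation.prodMap {K L₁ L₂ : Type*} [CommRing K] [LieRing L₁] [LieAlgebra K L₁]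
    [LieRing L₂] [LieAlgebra K L₂] (D₁ : LieDerivation K L₁ L₁) (D₂ : LieDerivation K L₂ L₂) :
    LieDerivation K (L₁ × L₂) (L₁ × L₂) where
  toLinearMap := D₁.toLinearMap.prodMap D₂.toLinearMap
  leibniz' a b := Prod.ext (D₁.leibniz' a.1 b.1) (D₂.leibniz' a.2 b.2)

theorem _root_.LieDerivation.prodMap_apply {K L₁ L₂ : Type*} [CommRing K] [LieRing L₁]
    [LieAlgebra K L₁] [LieRing L₂] [LieAlgebra K L₂] (D₁ : LieDerivation K L₁ L₁)
    (D₂ : LieDerivation K L₂ L₂) (z : L₁ × L₂) :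
    LieDerivation.prodMap D₁ D₂ z = (D₁ z.1, D₂ z.2) := rfl

/-- The action of the extension on the product of `m` and the invariants. -/
def spanAct : S.extension →ₗ⁅K⁆ LieDerivation K (m × AbelianLie (C.invariants Q))
    (m × AbelianLie (C.invariants Q)) where
  toFun z := (C.act (S.extensionProj z)).prodMap
    (spliceAct K C.Coker (C.invariants Q) (C.proj (S.extensionProj z)))
  map_add' y z := LieDerivation.ext fun w ↦ by
    simp only [LieDerivation.prodMap_apply, LieDerivation.add_apply, map_add, Prod.mk_add_mk]
  map_smul' t z := LieDerivation.ext fun w ↦ by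
    simp only [LieDerivation.prodMap_apply, LieDerivation.smul_apply, map_smul, Prod.smul_mk,
      RingHom.id_apply]
  map_lie' {y z} := LieDerivation.ext fun w ↦ by
    simp only [LieDerivation.prodMap_apply, LieDerivation.lie_apply, LieHom.map_lie,
      Prod.mk_sub_mk]

theorem spanAct_apply (z : S.extension) (a : m) (q : C.invariants Q) :
    S.spanAct z (a, AbelianLie.of K _ q) =
      (C.act (S.extensionProj z) a, AbelianLie.of K _ ⁅C.proj (S.extensionProj z), q⁆) := rfl

/-- The crossed module that maps to both `C` and its abelian replacement. -/
def span : LieCrossedModule K (m × AbelianLie (C.invariants Q)) S.extension where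
  μ := S.spanMap
  act := S.spanAct
  map_act z w := by
    obtain ⟨a, q⟩ := w
    obtain ⟨q, rfl⟩ := (AbelianLie.of K _).surjective q
    rw [spanAct_apply]
    refine S.extension_ext ?_ ?_
    · rw [extensionProj_spanMap, LieHom.map_lie, extensionProj_spanMap, C.map_act]
    · rw [extensionLeft_lie, extensionLeft_spanMap, extensionLeft_spanMap, extensionProj_spanMap,
        extension_lie_left, C.coe_proj_lie, lie_add]
      abel
  act_map y z := by
    obtain ⟨a, q⟩ := z
    obtain ⟨q, rfl⟩ := (AbelianLie.of K _).surjective q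
    rw [spanAct_apply, extensionProj_spanMap, C.act_map, C.proj_eq_zero.2 ⟨y.1, rfl⟩, zero_lie]
    rfl

end

section

universe uK w

variable {K : Type uK} {m n Q : Type w} [CommRing K] [LieRing m] [LieAlgebra K m] [LieRing n]
  [LieAlgebra K n] {C : LieCrossedModule K m n} [AddCommGroup Q] [Module K Q] [LieRingModule n Q]
  [LieModule K n Q] (S : C.Splitting Q)

/-- The crossed module `LieCrossedModule.Splitting.span` with its exact sequence. -/
def spanOver : LieCrossedModuleOver.{uK, w, w, w} K C.Coker C.Ker where
  m := m × AbelianLie (C.invariants Q)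
  n := S.extension
  crossed := S.span
  i := C.incl.prod ((AbelianLie.of K (C.invariants Q)).toLinearMap ∘ₗ
    (S.kerHom : C.Ker →ₗ[K] C.invariants Q))
  π := C.proj.comp S.extensionProj
  i_injective v w h := C.incl_injective congr(($h).1)
  exact_m z := by
    obtain ⟨a, q⟩ := z
    obtain ⟨q, rfl⟩ := (AbelianLie.of K _).surjective q
    constructor
    · intro h
      have h₁ : C.μ a = 0 := congr(S.extensionProj $h)
      have h₂ : S.j a + q = 0 := congr(S.extensionLeft $h)
      obtain ⟨v, rfl⟩ := C.exists_incl_eq h₁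
      refine ⟨v, Prod.ext rfl ?_⟩
      refine congr(AbelianLie.of K _ $(Subtype.ext ?_))
      exact neg_eq_of_add_eq_zero_right h₂
    · rintro ⟨v, hv⟩
      obtain rfl : C.incl v = a := congr(($hv).1)
      obtain rfl : S.kerHom v = q := (AbelianLie.of K _).injective congr(($hv).2)
      refine S.extension_ext (C.map_incl v) ?_
      change S.extensionLeft (S.spanMap _) = 0
      rw [extensionLeft_spanMap, coe_kerHom, add_neg_cancel]
  exact_n z := by
    constructor
    · intro h
      obtain ⟨a, ha⟩ := C.proj_eq_zero.1 h
      replace ha : C.μ a = S.extensionProj z := ha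
      have hq : S.extensionLeft z - S.j a ∈ C.invariants Q := by
        intro a'
        rw [lie_sub, extension_lie_left, ← ha, C.act_map, S.j_lie]
        abel
      refine ⟨(a, AbelianLie.of K _ ⟨_, hq⟩), S.extension_ext ha ?_⟩
      change S.extensionLeft (S.spanMap _) = _
      rw [extensionLeft_spanMap, add_sub_cancel]
    · rintro ⟨y, rfl⟩
      exact C.proj_eq_zero.2 ⟨y.1, rfl⟩
  π_surjective ξ := by
    obtain ⟨x, rfl⟩ := C.proj_surjective ξ
    exact ⟨S.extensionMk x (S.J x) (S.lie_J x), rfl⟩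
  i_lie z v := by
    refine Prod.ext rfl ?_
    exact congr(AbelianLie.of K _ $(S.kerHom.map_lie (C.proj (S.extensionProj z)) v))

theorem spanOver_to : LieCrossedModuleOver.ElementaryEquivalence S.spanOver C.toOver :=
  ⟨LieHom.fst K m _, S.extensionProj, fun _ ↦ rfl, fun _ _ ↦ rfl, fun _ ↦ rfl, fun _ ↦ rfl⟩

theorem spanOver_to_splice (α : twoCocycle K C.Coker S.Quot)
    (hα : ∀ x y, (α : C.Coker →ₗ[K] C.Coker →ₗ[K] S.Quot) (C.proj x) (C.proj y) =
        S.quotMk (S.curvature x y))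
    (hexact : Function.Exact S.kerHom S.quotMk) :
    LieCrossedModuleOver.ElementaryEquivalence S.spanOver
      (LieCrossedModuleOver.splice S.kerHom S.quotMk S.kerHom_injective hexact
        S.quotMk_surjective α) := by
  have hmem : ∀ z : S.extension, S.extensionLeft z - S.J (S.extensionProj z) ∈ C.invariants Q := by
    intro z a
    rw [lie_sub, extension_lie_left, S.lie_J, sub_self]
  obtain ⟨D, hD⟩ : ∃ D : S.extension →ₗ[K] C.invariants Q,
      ∀ z, (D z : Q) = S.extensionLeft z - S.J (S.extensionProj z) :=
    ⟨(S.extensionLeft - S.J ∘ₗ (S.extensionProj : S.extension →ₗ[K] n)).codRestrict _ hmem,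
      fun _ ↦ rfl⟩
  -- For (q, x) in the extension, q − J(x) is invariant. Taking it as a coordinate turns the bracket
  -- of Q ⋊ n into that of an extension twisted by the coboundary of J, which is α modulo V.
  let ψ : S.extension →ₗ⁅K⁆ LieAlgebra.ofTwoCocycle α :=
    { toFun z := LieAlgebra.ofProd α (C.proj (S.extensionProj z), S.quotMk (D z))
      map_add' y z := by simp only [map_add, ← LieAlgebra.of_add, Prod.mk_add_mk]
      map_smul' t z := by
        simp only [map_smul, ← LieAlgebra.of_smul, Prod.smul_mk, RingHom.id_apply]
      map_lie' {y z} := by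
        rw [LieAlgebra.bracket_ofTwoCocycle]
        simp only [Equiv.symm_apply_apply]
        rw [hα]
        simp only [← LieModuleHom.map_lie, ← map_add, ← map_sub, LieHom.map_lie]
        congr 3
        apply Subtype.ext
        rw [Submodule.coe_sub, Submodule.coe_add, C.coe_proj_lie, C.coe_proj_lie, hD, hD, hD,
          extensionLeft_lie, coe_curvature, lie_sub, lie_sub, LieHom.map_lie]
        abel }
  let φ : m × AbelianLie (C.invariants Q) →ₗ⁅K⁆ AbelianLie (C.invariants Q) := LieHom.snd K m _
  refine ⟨φ, ψ, ?_, fun _ _ ↦ rfl, fun _ ↦ rfl, fun _ ↦ rfl⟩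
  rintro ⟨a, q⟩
  obtain ⟨q, rfl⟩ := (AbelianLie.of K _).surjective q
  change LieAlgebra.ofProd α (0, S.quotMk q) =
    LieAlgebra.ofProd α (C.proj (C.μ a), S.quotMk (D (S.spanMap _)))
  rw [C.proj_eq_zero.2 ⟨a, rfl⟩]
  congr 2
  rw [← sub_eq_zero, ← map_sub, quotMk_eq_zero]
  obtain ⟨v, hv⟩ := S.J_map a
  -- The two sides differ by q − (j(a) + q − J(μ(a))) = j(v), the image of −v.
  refine ⟨-v, Subtype.ext ?_⟩
  rw [Submodule.coe_sub, hD, coe_kerHom]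
  rw [extensionLeft_spanMap, extensionProj_spanMap, hv, map_neg, map_neg]
  abel

theorem exact_kerHom : Function.Exact S.kerHom S.quotMk := fun _ ↦ S.quotMk_eq_zero

end

end LieCrossedModule.Splitting

theorem mainTheorem9 {K : Type u} [Field K] {m n : Type (max u v)}
    [LieRing m] [LieAlgebra K m] [LieRing n] [LieAlgebra K n] (C : LieCrossedModule K m n) :
    ∃ (V₂ V₃ : Type (max u v))
      (_ : AddCommGroup V₂) (_ : Module K V₂) (_ : LieRingModule C.Coker V₂)
      (_ : LieModule K C.Coker V₂)
      (_ : AddCommGroup V₃) (_ : Module K V₃) (_ : LieRingModule C.Coker V₃)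
      (_ : LieModule K C.Coker V₃)
      (i : C.Ker →ₗ⁅K, C.Coker⁆ V₂) (d : V₂ →ₗ⁅K, C.Coker⁆ V₃)
      (hi : Function.Injective i) (hid : Function.Exact i d) (hd : Function.Surjective d)
      (α : LieModule.Cohomology.twoCocycle K C.Coker V₃),
      LieCrossedModuleOver.Equivalent C.toOver
        (LieCrossedModuleOver.splice i d hi hid hd α) := by
  obtain ⟨Q, _, _, _, _, j, hj, hv, hx⟩ := C.exists_splitting_module
  obtain ⟨S⟩ := C.nonempty_splitting Q j hj hv hx
  obtain ⟨α, hα⟩ := S.exists_twoCocycle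
    ((C.proj : n →ₗ[K] C.Coker).exists_rightInverse_of_surjective
      (LinearMap.range_eq_top.2 C.proj_surjective))
  refine ⟨C.invariants Q, S.Quot, inferInstance, inferInstance, inferInstance, inferInstance,
    inferInstance, inferInstance, inferInstance, inferInstance, S.kerHom, S.quotMk,
    S.kerHom_injective, S.exact_kerHom, S.quotMk_surjective, α, ?_⟩
  exact .trans _ _ _ (.symm _ _ (.rel _ _ S.spanOver_to))
    (.rel _ _ (S.spanOver_to_splice α hα S.exact_kerHom))
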